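/- Let $M_0(x,t)$ and $R(x,t)$ be continuous complex-valued functions on the triangle $0\le t\le x\le\pi$, and let $P,\tilde P$ be continuous complex-valued functions on $[0,\pi]$. Put $$M(x,t)=M_0(x,t)+R(x,t)P(x-t),\qquad \tilde M(x,t)=M_0(x,t)+R(x,t)\tilde P(x-t),\qquad 0\le t\le x\le\pi,$$ and assume that $$B(x):=\int_0^x R(\pi-t,x-t)\,dt\neq 0\qquad\text{for } 0<x\le\pi .$$ For a continuous kernel $M$, let $Q(M)$ denote the boundary value problem $$iy'(x)+\int_0^x M(x,t)y(t)\,dt=\lambda y(x),\quad x\in[0,\pi],\qquad y(\pi)=0 ,$$ whose eigenvalues are the $\lambda\in\mathbb C$ for which it has a solution $y\not\equiv0$. The (algebraic) multiplicity of an eigenvalue $\lambda$ is the dimension of its root space, i.e. of the space of functions $y$ on $[0,\pi]$ with $(L-\lambda)^k y=0$ for some $k\ge1$, where $Ly(x)=iy'(x)+\int_0^xM(x,t)y(t)\,dt$ on the domain of differentiable functions $y$ on $[0,\pi]$ with $y(\pi)=0$. If $Q(M)$ and $Q(\tilde M)$ have the same eigenvalues, counted with multiplicity, then $P(x)=\tilde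 P(x)$ for all $x\in[0,\pi]$. -/

import Mathlib

open scoped Real

noncomputable section

/-- The triangle `0 ≤ t ≤ x ≤ π` of points `(x, t)`. -/
def triangle : Set (ℝ × ℝ) := {p | 0 ≤ p.2 ∧ p.2 ≤ p.1 ∧ p.1 ≤ π}

/-- The integro-differential expression `ℓ y (x) = i y'(x) + ∫_0^x M(x,t) y(t) dt` on `[0, π]`
(one-sided derivatives at the end points). -/
def integroDiff (M : ℝ → ℝ → ℂ) (y : ℝ → ℂ) (x : ℝ) : ℂ :=
  Complex.I * derivWithin y (Set.Icc 0 π) x + ∫ t in (0 : ℝ)..x, M x t * y t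

/-- `y` is in the domain of the boundary value problem: it is differentiable on `[0, π]`
and `y(π) = 0`. -/
def InDomain (y : ℝ → ℂ) : Prop :=
  DifferentiableOn ℝ y (Set.Icc 0 π) ∧ y π = 0

/-- `μ` is an eigenvalue of the boundary value problem `Q(M)`: the problem
`ℓ y = μ y` on `[0, π]`, `y(π) = 0`, has a solution that is not identically zero on `[0, π]`. -/
def IsEigenvalue (M : ℝ → ℝ → ℂ) (μ : ℂ) : Prop :=
  ∃ y : ℝ → ℂ, InDomain y ∧ (∀ x ∈ Set.Icc 0 π, integroDiff M y x = μ * y x) ∧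
    ∃ x ∈ Set.Icc 0 π, y x ≠ 0

/-- `(L - μ)^k y = 0` on `[0, π]`, where `L` is the operator `ℓ` with the boundary condition
`y(π) = 0` (so every intermediate function `(L - μ)^j y`, `j < k`, lies in the domain). -/
def IsRootFunction (M : ℝ → ℝ → ℂ) (μ : ℂ) : ℕ → (ℝ → ℂ) → Prop
  | 0, y => ∀ x ∈ Set.Icc 0 π, y x = 0
  | k + 1, y => InDomain y ∧ ∃ z : ℝ → ℂ, IsRootFunction M μ k z ∧
      ∀ x ∈ Set.Icc 0 π, integroDiff M y x - μ * y x = z x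

/-- The space spanned by the root functions (eigenfunctions and associated functions) of `Q(M)`
at `μ`, as functions on `[0, π]`. -/
def rootSpace (M : ℝ → ℝ → ℂ) (μ : ℂ) : Submodule ℂ (Set.Icc (0 : ℝ) π → ℂ) :=
  Submodule.span ℂ ((Set.Icc (0 : ℝ) π).domRestrict '' {y | ∃ k, IsRootFunction M μ k y})

/-- The (algebraic) multiplicity of `μ` as an eigenvalue of `Q(M)`: the dimension of its
root space. -/
def algMultiplicity (M : ℝ → ℝ → ℂ) (μ : ℂ) : Cardinal :=
  Module.rank ℂ (rootSpace M μ)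

/-- `Q(M)` and `Q(N)` have the same eigenvalues, counted with multiplicities. -/
def SameSpectrum (M N : ℝ → ℝ → ℂ) : Prop :=
  (∀ μ, IsEigenvalue M μ ↔ IsEigenvalue N μ) ∧
    ∀ μ, IsEigenvalue M μ → algMultiplicity M μ = algMultiplicity N μ

end

/-! Write Δ(λ) for the value at π of the solution of `ℓ y = λ y` with y(0) = 1. A transmutation
operator `T g (x) = g x + ∫₀ˣ K(x,t) g(t) dt` satisfies `ℓ T = T (i d/dx)` and preserves values at
0, so that solution is `T (exp (-iλ·))` and Δ(λ) = exp(-iλπ) + ∫₀^π K(π,t) exp(-iλt) dt. The kernel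
is K(x,t) = h(x-t, t), where h solves an integral equation that is Volterra in its second variable
(`exists_isTransmutationKernel`).

The spectrum determines Δ. The images under T of (-ix)^j/j! · exp(-iμx) form a Jordan chain for `ℓ`,
and their values at π are Δ^(j)(μ)/j!; hence the root space at μ has dimension equal to the order of
vanishing of Δ there (`algMultiplicity_eq`). Both characteristic functions are entire of exponential
type and, multiplied by exp(-πy), tend to 1 at iy. Their quotient is entire and zero-free, hence the
exponential of an affine function, and the limit along the ray makes it 1
(`entire_eq_of_analyticOrderAt_eq`).

Equality of the functions Δ gives, by Fourier inversion, equality of the two kernels on the line x =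
π, that is, h(a, π-a) = h'(a, π-a).

The coordinate a = x-t is adapted to the perturbation: in the equation for h(a, ·) the factor P
enters only through P(a) and its values on [0,a]. Subtracting the two equations and evaluating at s
= π-a, where the difference vanishes, expresses (P-P')(a) · B(π-a) through P-P' and h-h' on [0,a].
As B(π-a) ≠ 0 for a < π, this together with the equation for h-h' is a homogeneous linear Volterra
system, so P = P' on [0,π) (`eq_of_kernel_eq`), and at π by continuity. -/

/-! ### Entire functions of exponential type with equal zeros -/

open Filter Topology Metric Complex in
theorem exists_entire_ne_zero_mul_eq {f g : ℂ → ℂ} (hf : Differentiable ℂ f)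
    (hg : Differentiable ℂ g) (hord : ∀ z, analyticOrderAt f z = analyticOrderAt g z)
    (hne : ∀ z, analyticOrderAt f z ≠ ⊤) :
    ∃ F : ℂ → ℂ, Differentiable ℂ F ∧ (∀ z, F z ≠ 0) ∧ ∀ z, g z = F z * f z := by
  have hex : ∀ z, ∃ n : ℕ, ∃ φ ψ : ℂ → ℂ, AnalyticAt ℂ φ z ∧ AnalyticAt ℂ ψ z ∧ φ z ≠ 0 ∧
      ψ z ≠ 0 ∧ (∀ᶠ w in 𝓝 z, f w = (w - z) ^ n * φ w) ∧
      (∀ᶠ w in 𝓝 z, g w = (w - z) ^ n * ψ w) := by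
    intro z
    obtain ⟨n, hn⟩ := ENat.ne_top_iff_exists.1 (hne z)
    obtain ⟨φ, h1, h2, h3⟩ := (hf.analyticAt z).analyticOrderAt_eq_natCast.1 hn.symm
    obtain ⟨ψ, h4, h5, h6⟩ :=
      (hg.analyticAt z).analyticOrderAt_eq_natCast.1 ((hord z).symm.trans hn.symm)
    exact ⟨n, φ, ψ, h1, h4, h2, h5, h3, h6⟩
  choose n φ ψ hφ hψ hφ0 hψ0 hfe hge using hex
  have hn0 : ∀ w, f w ≠ 0 → ψ w w / φ w w = g w / f w := by
    intro w hw
    have h1 := (hfe w).self_of_nhds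
    have h2 := (hge w).self_of_nhds
    have h3 : n w = 0 := by
      by_contra h
      simp [h] at h1
      exact hw h1
    simp only [h3, pow_zero, one_mul] at h1 h2
    rw [h1, h2]
  -- The value at each point uses the local factors chosen at that same point. Near z this agrees
  -- with the analytic quotient ψ z / φ z, since away from z both equal g / f.
  refine ⟨fun z => ψ z z / φ z z, fun z => ?_, fun z => div_ne_zero (hψ0 z) (hφ0 z), fun z => ?_⟩
  · have : (fun w => ψ w w / φ w w) =ᶠ[𝓝 z] fun w => ψ z w / φ z w := by
      filter_upwards [hfe z, hge z, (hφ z).continuousAt.eventually_ne (hφ0 z)] with w h1 h2 h3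
      rcases eq_or_ne w z with rfl | hw
      · rfl
      · have h4 : (w - z) ^ n z ≠ 0 := pow_ne_zero _ (sub_ne_zero.2 hw)
        have h5 : f w ≠ 0 := by rw [h1]; exact mul_ne_zero h4 h3
        rw [hn0 w h5, h1, h2]
        field_simp
    exact (((hψ z).div (hφ z) (hφ0 z)).differentiableAt.congr_of_eventuallyEq this)
  · have h1 := (hfe z).self_of_nhds
    have h2 := (hge z).self_of_nhds
    have := hφ0 z
    rw [h1, h2]
    field_simp

-- With u = log ‖f‖ ≤ A and A ≥ 0, one has |u| ≤ 2A - u pointwise, and Jensen's formula bounds the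
-- mean of u below by u(c).
open Metric Real in
theorem circleAverage_abs_log_norm_le {f : ℂ → ℂ} (hf : Differentiable ℂ f) {c : ℂ} {R A : ℝ}
    (hc : f c ≠ 0) (hR : 0 < R) (hA : 0 ≤ A) (hfA : ∀ z ∈ sphere c |R|, ‖f z‖ ≤ Real.exp A) :
    circleAverage (fun z => |Real.log ‖f z‖|) c R ≤ 2 * A - Real.log ‖f c‖ := by
  have hint : CircleIntegrable (fun z => Real.log ‖f z‖) c R :=
    MeromorphicOn.circleIntegrable_log_norm fun z _ => (hf.analyticAt z).meromorphicAt
  have hjensen : Real.log ‖f c‖ ≤ circleAverage (fun z => Real.log ‖f z‖) c R := by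
    rw [AnalyticOnNhd.circleAverage_log_norm hR.ne' (fun z _ => hf.analyticAt z) hc]
    have han : AnalyticOnNhd ℂ f (closedBall c |R|) := fun z _ => hf.analyticAt z
    have : 0 ≤ ∑ᶠ u, MeromorphicOn.divisor f (closedBall c |R|) u * Real.log (R * ‖c - u‖⁻¹) := by
      refine finsum_nonneg fun u => ?_
      by_cases hu : u ∈ closedBall c |R|
      · refine mul_nonneg ?_ ?_
        · exact_mod_cast MeromorphicOn.AnalyticOnNhd.divisor_nonneg han u
        · rcases eq_or_ne u c with rfl | hne
          · simp
          · refine Real.log_nonneg ?_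
            have h1 : 0 < ‖c - u‖ := norm_pos_iff.2 (sub_ne_zero.2 hne.symm)
            rw [mem_closedBall, dist_comm, dist_eq_norm, abs_of_pos hR] at hu
            rw [← div_eq_mul_inv, le_div_iff₀ h1]
            linarith
      · simp [Function.locallyFinsuppWithin.apply_eq_zero_of_notMem _ hu]
    linarith
  have hle : circleAverage (fun z => |Real.log ‖f z‖|) c R ≤
      circleAverage (fun z => 2 * A - Real.log ‖f z‖) c R := by
    refine circleAverage_mono hint.abs ((circleIntegrable_const _ _ _).sub hint) fun z hz => ?_
    have hlog : Real.log ‖f z‖ ≤ A := by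
      rcases eq_or_ne (f z) 0 with h0 | h0
      · simpa [h0] using hA
      · rw [Real.log_le_iff_le_exp (norm_pos_iff.2 h0)]
        exact hfA z hz
    rw [abs_le]
    constructor <;> linarith
  rw [circleAverage_fun_sub (circleIntegrable_const _ _ _) hint, circleAverage_const] at hle
  linarith

-- On the circle of radius 2r the Poisson kernel at w is nonnegative and at most (2r + r)/(2r - r) =
-- 3. This turns a mean bound into a pointwise one.
open Metric Real InnerProductSpace in
theorem harmonic_le_three_mul_circleAverage_abs {u : ℂ → ℝ} (hu : HarmonicOnNhd u Set.univ)
    {c w : ℂ} {r : ℝ} (hr : 0 < r) (hw : ‖w - c‖ ≤ r) :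
    u w ≤ 3 * circleAverage (fun z => |u z|) c (2 * r) := by
  have hwb : w ∈ ball c (2 * r) := by
    rw [mem_ball, dist_eq_norm]; linarith
  have hcont : Continuous u := continuous_iff_continuousAt.2 fun z =>
    (hu z (Set.mem_univ z)).1.continuousAt
  have h2r : |2 * r| = 2 * r := abs_of_pos (by linarith)
  rw [← HarmonicOnNhd.circleAverage_re_herglotzRieszKernel_smul
    (fun z _ => hu z (Set.mem_univ z)) hwb, show 3 * circleAverage (fun z => |u z|) c (2 * r) =
      circleAverage (fun z => 3 * |u z|) c (2 * r) from (circleAverage_fun_smul (𝕜 := ℝ)).symm]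
  have hci : ∀ v : ℂ → ℝ, Continuous v → CircleIntegrable v c (2 * r) := fun v hv =>
    ContinuousOn.circleIntegrable' hv.continuousOn
  refine circleAverage_mono ?_ (hci _ (by fun_prop)) fun z hz => ?_
  · refine ContinuousOn.circleIntegrable' ?_
    exact (Complex.continuous_re.comp_continuousOn
      (continuousOn_herglotzRieszKernel_sphere hwb)).smul hcont.continuousOn
  · rw [h2r] at hz
    have h1 := re_herglotzRieszKernel_le hz hwb
    have h2 := le_re_herglotzRieszKernel hz hwb
    have h3 : (2 * r + ‖w - c‖) / (2 * r - ‖w - c‖) ≤ 3 := by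
      rw [div_le_iff₀ (by linarith)]; linarith
    have h4 : 0 ≤ (2 * r - ‖w - c‖) / (2 * r + ‖w - c‖) :=
      div_nonneg (by linarith) (by have := norm_nonneg (w - c); linarith)
    simp only [Pi.smul_apply', Function.comp_apply, smul_eq_mul, herglotzRieszKernel_def]
    calc _ ≤ ((z - c + (w - c)) / (z - c - (w - c))).re * |u z| := by
          gcongr
          · linarith
          · exact le_abs_self _
      _ ≤ 3 * |u z| := by gcongr; linarith

-- Borel–Carathéodory on the disc of radius 2(‖z‖ + 1) upgrades the one-sided bound on the real part
-- to linear growth of ‖G‖. Cauchy's estimate for G'' on circles of radius R → ∞ then gives G'' = 0.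
open Filter Topology Metric in
theorem exists_eq_add_mul_of_re_le {G : ℂ → ℂ} (hG : Differentiable ℂ G) {K : ℝ} (hK : 0 < K)
    (hre : ∀ z, (G z).re ≤ K * (1 + ‖z‖)) : ∃ α β : ℂ, ∀ z, G z = α + β * z := by
  have hbound : ∀ z, ‖G z‖ ≤ (12 * K + 3 * ‖G 0‖) * (1 + ‖z‖) := by
    intro z
    have hz0 := norm_nonneg z
    have hM : 0 < K * (1 + 2 * (‖z‖ + 1)) := by positivity
    have hzb : z ∈ ball (0 : ℂ) (2 * (‖z‖ + 1)) := by
      rw [mem_ball_zero_iff]; linarith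
    have h := Complex.borelCaratheodory hM (f := G) (R := 2 * (‖z‖ + 1)) hG.differentiableOn
      (fun w hw => by
        rw [mem_ball_zero_iff] at hw
        exact (hre w).trans (by gcongr)) (by positivity) hzb
    have h1 : 2 * (K * (1 + 2 * (‖z‖ + 1))) * ‖z‖ / (2 * (‖z‖ + 1) - ‖z‖) ≤
        12 * K * (1 + ‖z‖) := by
      rw [div_le_iff₀ (by linarith)]
      nlinarith [mul_nonneg hK.le hz0, mul_nonneg (mul_nonneg hK.le hz0) hz0]
    have h2 : ‖G 0‖ * (2 * (‖z‖ + 1) + ‖z‖) / (2 * (‖z‖ + 1) - ‖z‖) ≤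
        3 * ‖G 0‖ * (1 + ‖z‖) := by
      have := norm_nonneg (G 0)
      rw [div_le_iff₀ (by linarith)]
      nlinarith [mul_nonneg this hz0, mul_nonneg (mul_nonneg this hz0) hz0]
    linarith
  set K' := 12 * K + 3 * ‖G 0‖ with hK'
  have hK'0 : 0 ≤ K' := by positivity
  have hdd : ∀ c, deriv (deriv G) c = 0 := by
    intro c
    have hle : ∀ R : ℝ, 0 < R → ‖deriv (deriv G) c‖ ≤ 2 * (K' * (1 + ‖c‖ + R)) / R ^ 2 := by
      intro R hR
      have := Complex.norm_iteratedDeriv_le_of_forall_mem_sphere_norm_le (f := G) (c := c)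
        (C := K' * (1 + ‖c‖ + R)) 2 hR hG.diffContOnCl (fun z hz => by
          refine (hbound z).trans ?_
          have : ‖z‖ ≤ ‖c‖ + R := by
            rw [mem_sphere, dist_eq_norm] at hz
            calc ‖z‖ = ‖c + (z - c)‖ := by ring_nf
              _ ≤ ‖c‖ + R := hz ▸ norm_add_le _ _
          rw [add_assoc]
          gcongr)
      simpa [iteratedDeriv_succ] using this
    have hlim : Tendsto (fun R : ℝ => 2 * (K' * (1 + ‖c‖ + R)) / R ^ 2) atTop (𝓝 0) := by
      have h1 : Tendsto (fun R : ℝ => 2 * K' * (1 + ‖c‖) * (R⁻¹ * R⁻¹) + 2 * K' * R⁻¹) atTop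
          (𝓝 (2 * K' * (1 + ‖c‖) * (0 * 0) + 2 * K' * 0)) :=
        ((tendsto_inv_atTop_zero.mul tendsto_inv_atTop_zero).const_mul _).add
          (tendsto_inv_atTop_zero.const_mul _)
      simp only [mul_zero, add_zero] at h1
      refine h1.congr' ?_
      filter_upwards [eventually_gt_atTop 0] with R hR
      field_simp
    have h0 : ‖deriv (deriv G) c‖ ≤ 0 :=
      ge_of_tendsto hlim ((eventually_gt_atTop 0).mono hle)
    exact norm_le_zero_iff.1 h0
  have hd1 : ∀ z, deriv G z = deriv G 0 := fun z =>
    is_const_of_deriv_eq_zero hG.deriv hdd z 0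
  refine ⟨G 0, deriv G 0, fun z => ?_⟩
  have hc := is_const_of_deriv_eq_zero (f := fun z => G z - deriv G 0 * z)
    (hG.sub (differentiable_id.const_mul _)) (fun w => by
      have : HasDerivAt (fun z => G z - deriv G 0 * z) (deriv G w - deriv G 0 * 1) w :=
        (hG w).hasDerivAt.sub ((hasDerivAt_id w).const_mul _)
      rw [this.deriv, hd1 w]; ring) z 0
  simp only [mul_zero, sub_zero] at hc
  linear_combination hc

open Filter Topology Metric Real InnerProductSpace in
/-- Two entire functions of exponential type with the same zeros, counted with multiplicities,
whose ratio tends to `1` along the positive imaginary axis, are equal. -/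
theorem entire_eq_of_analyticOrderAt_eq {f g : ℂ → ℂ} (hf : Differentiable ℂ f)
    (hg : Differentiable ℂ g) {A : ℝ} (hA : 0 ≤ A)
    (hfA : ∀ z, ‖f z‖ ≤ Real.exp (A * (1 + ‖z‖))) (hgA : ∀ z, ‖g z‖ ≤ Real.exp (A * (1 + ‖z‖)))
    (hord : ∀ z, analyticOrderAt f z = analyticOrderAt g z)
    (hlim : Tendsto (fun y : ℝ => g (Complex.I * y) / f (Complex.I * y)) atTop (𝓝 1)) :
    f = g := by
  have hev : ∀ᶠ y : ℝ in atTop, f (Complex.I * y) ≠ 0 := by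
    filter_upwards [hlim.eventually_ne one_ne_zero] with y hy h0
    simp [h0] at hy
  obtain ⟨y₀, hy₀⟩ := hev.exists
  set c : ℂ := Complex.I * y₀ with hc
  have hne : ∀ z, analyticOrderAt f z ≠ ⊤ := fun z =>
    AnalyticOnNhd.analyticOrderAt_ne_top_of_isPreconnected (U := Set.univ)
      (fun z _ => hf.analyticAt z) isPreconnected_univ (Set.mem_univ c) (Set.mem_univ z)
      (by rw [(hf.analyticAt c).analyticOrderAt_eq_zero.2 hy₀]; exact ENat.zero_ne_top)
  obtain ⟨F, hF, hF0, hgF⟩ := exists_entire_ne_zero_mul_eq hf hg hord hne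
  have hgc : g c ≠ 0 := by rw [hgF]; exact mul_ne_zero (hF0 c) hy₀
  have hharm : HarmonicOnNhd (fun z => Real.log ‖F z‖) Set.univ := fun z _ =>
    (hF.analyticAt z).harmonicAt_log_norm (hF0 z)
  obtain ⟨G, hGan, hGre⟩ := hharm.exists_analyticOnNhd_univ_re_eq
  have hG : Differentiable ℂ G := fun z => (hGan z (Set.mem_univ z)).differentiableAt
  -- the mean of `|log ‖F‖|` over large circles
  have hmean : ∀ R : ℝ, 0 < R → circleAverage (fun z => |Real.log ‖F z‖|) c R ≤
      4 * (A * (1 + ‖c‖ + R)) - Real.log ‖f c‖ - Real.log ‖g c‖ := by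
    intro R hR
    -- The identity log ‖F‖ = log ‖g‖ - log ‖f‖ may fail at zeros of f, where `Real.log 0 = 0`;
    -- these form a discrete set, which the average ignores.
    have hcongr : circleAverage (fun z => |Real.log ‖F z‖|) c R =
        circleAverage (fun z => |Real.log ‖g z‖ - Real.log ‖f z‖|) c R := by
      refine circleAverage_congr_codiscreteWithin ?_ hR.ne'
      have hcod : {z | f z ≠ 0} ∈ codiscreteWithin (sphere c |R|) := by
        have h2 : {z | f z ≠ 0} ∈ codiscreteWithin (Set.univ : Set ℂ) := by
          have hfr : AnalyticOnNhd ℂ f Set.univ := fun z _ => hf.analyticAt z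
          exact hfr.preimage_zero_mem_codiscrete (x := c) hy₀
        exact codiscreteWithin_mono (Set.subset_univ _) h2
      filter_upwards [hcod] with z hz
      have hz : f z ≠ 0 := hz
      rw [hgF z, norm_mul, Real.log_mul (norm_ne_zero_iff.2 (hF0 z)) (norm_ne_zero_iff.2 hz)]
      ring_nf
    have hintf : CircleIntegrable (fun z => Real.log ‖f z‖) c R :=
      MeromorphicOn.circleIntegrable_log_norm fun z _ => (hf.analyticAt z).meromorphicAt
    have hintg : CircleIntegrable (fun z => Real.log ‖g z‖) c R :=
      MeromorphicOn.circleIntegrable_log_norm fun z _ => (hg.analyticAt z).meromorphicAt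
    have hsph : ∀ z ∈ sphere c |R|, ‖z‖ ≤ ‖c‖ + R := fun z hz => by
      rw [mem_sphere, dist_eq_norm, abs_of_pos hR] at hz
      calc ‖z‖ = ‖c + (z - c)‖ := by ring_nf
        _ ≤ ‖c‖ + R := hz ▸ norm_add_le _ _
    have hA' : 0 ≤ A * (1 + ‖c‖ + R) := by positivity
    have h1 := circleAverage_abs_log_norm_le hf hy₀ hR hA' fun z hz =>
      (hfA z).trans (Real.exp_le_exp.2 (by rw [add_assoc]; gcongr; exact hsph z hz))
    have h2 := circleAverage_abs_log_norm_le hg hgc hR hA' fun z hz =>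
      (hgA z).trans (Real.exp_le_exp.2 (by rw [add_assoc]; gcongr; exact hsph z hz))
    have h3 : circleAverage (fun z => |Real.log ‖g z‖ - Real.log ‖f z‖|) c R ≤
        circleAverage (fun z => |Real.log ‖g z‖| + |Real.log ‖f z‖|) c R :=
      circleAverage_mono (hintg.sub hintf).abs (hintg.abs.add hintf.abs)
        fun z _ => abs_sub _ _
    have h4 : circleAverage (fun z => |Real.log ‖g z‖| + |Real.log ‖f z‖|) c R = _ :=
      circleAverage_fun_add hintg.abs hintf.abs
    rw [h4] at h3
    rw [hcongr]
    linarith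
  obtain ⟨α, β, hαβ⟩ : ∃ α β : ℂ, ∀ z, G z = α + β * z := by
    set L := |Real.log ‖f c‖| + |Real.log ‖g c‖| with hL
    have hL0 : 0 ≤ L := by positivity
    refine exists_eq_add_mul_of_re_le hG
      (K := 3 * (4 * A * (3 + 3 * ‖c‖) + L) + 1) (by positivity) fun z => ?_
    have hr : 0 < ‖z‖ + ‖c‖ + 1 := by positivity
    have h1 := harmonic_le_three_mul_circleAverage_abs hharm (c := c) (w := z) hr
      ((norm_sub_le _ _).trans (by linarith))
    have h2 := hmean (2 * (‖z‖ + ‖c‖ + 1)) (by positivity)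
    have h3 : (G z).re = Real.log ‖F z‖ := congrFun hGre z
    rw [h3]
    have h4 : 4 * (A * (1 + ‖c‖ + 2 * (‖z‖ + ‖c‖ + 1))) ≤ 4 * A * (3 + 3 * ‖c‖) * (1 + ‖z‖) := by
      have := norm_nonneg z
      have := norm_nonneg c
      nlinarith [mul_nonneg hA (norm_nonneg z), mul_nonneg (mul_nonneg hA (norm_nonneg z)) this]
    have h5 := neg_abs_le (Real.log ‖f c‖)
    have h6 := neg_abs_le (Real.log ‖g c‖)
    have h7 : L ≤ L * (1 + ‖z‖) := by nlinarith [mul_nonneg hL0 (norm_nonneg z)]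
    nlinarith [norm_nonneg z]
  have hnorm : ∀ z, ‖F z‖ = ‖Complex.exp (G z)‖ := fun z => by
    have h3 : (G z).re = Real.log ‖F z‖ := congrFun hGre z
    rw [Complex.norm_exp, h3, Real.exp_log (norm_pos_iff.2 (hF0 z))]
  -- F · exp(-G) has modulus 1 everywhere, so Liouville's theorem applies.
  obtain ⟨k, hk⟩ := Differentiable.exists_const_forall_eq_of_bounded
    (f := fun z => F z * Complex.exp (-G z)) (hF.mul hG.neg.cexp) (by
      refine isBounded_iff_forall_norm_le.2 ⟨1, ?_⟩
      rintro _ ⟨z, rfl⟩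
      rw [norm_mul, hnorm z, ← norm_mul, ← Complex.exp_add]
      simp)
  have hFe : ∀ z, F z = k * Complex.exp α * Complex.exp (β * z) := fun z => by
    rw [← hk z, hαβ z, mul_assoc, mul_assoc, ← Complex.exp_add, ← Complex.exp_add]
    simp
  have hk0 : k * Complex.exp α ≠ 0 := by
    have := hF0 0
    rwa [hFe 0, mul_zero, Complex.exp_zero, mul_one] at this
  have hFlim : Tendsto (fun y : ℝ => F (Complex.I * y)) atTop (𝓝 1) := by
    refine hlim.congr' ?_
    filter_upwards [hev] with y hy
    rw [hgF, mul_div_cancel_right₀ _ hy]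
  -- The quotient F(i(y+s)) / F(iy) does not depend on y and tends to 1.
  have hshift : ∀ s : ℝ, Complex.exp (β * Complex.I * s) = 1 := by
    intro s
    have h1 : Tendsto (fun y : ℝ => F (Complex.I * (y + s : ℝ)) / F (Complex.I * y)) atTop
        (𝓝 (1 / 1)) :=
      (hFlim.comp (tendsto_atTop_add_const_right _ s tendsto_id)).div hFlim one_ne_zero
    have h2 : ∀ y : ℝ, F (Complex.I * (y + s : ℝ)) / F (Complex.I * y) =
        Complex.exp (β * Complex.I * s) := fun y => by
      rw [hFe, hFe, mul_div_mul_left _ _ hk0, ← Complex.exp_sub]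
      congr 1; push_cast; ring
    simp only [h2, div_one] at h1
    exact tendsto_nhds_unique tendsto_const_nhds h1
  have hconst : ∀ y : ℝ, F (Complex.I * y) = k * Complex.exp α := fun y => by
    rw [hFe, ← mul_assoc, hshift, mul_one]
  have hone : k * Complex.exp α = 1 := by
    simp only [hconst] at hFlim
    exact tendsto_nhds_unique tendsto_const_nhds hFlim
  have hβ : β = 0 := by
    have h1 : HasDerivAt (fun s : ℝ => Complex.exp (β * Complex.I * s)) (β * Complex.I) 0 := by
      have := (((hasDerivAt_id (0 : ℝ)).ofReal_comp).const_mul (β * Complex.I)).cexp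
      simpa using this
    have h2 : HasDerivAt (fun s : ℝ => Complex.exp (β * Complex.I * s)) 0 0 := by
      simp only [hshift]
      exact hasDerivAt_const _ _
    simpa using h1.unique h2
  funext z
  rw [hgF z, hFe z, hone, hβ]
  simp

/-! ### Integrals over triangles and weighted bounds -/

theorem integral_triangle_swap {f : ℝ → ℝ → ℂ} (hf : Continuous fun p : ℝ × ℝ => f p.1 p.2)
    {x : ℝ} (hx : 0 ≤ x) :
    ∫ s in (0 : ℝ)..x, ∫ a in (0 : ℝ)..s, f a s = ∫ a in (0 : ℝ)..x, ∫ s in a..x, f a s := by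
  let F : ℝ → ℝ → ℂ := fun s a => Set.indicator {p : ℝ × ℝ | p.2 < p.1} (fun p => f p.2 p.1) (s, a)
  have h1 : ∀ s ∈ Set.uIcc 0 x, ∫ a in (0 : ℝ)..s, f a s = ∫ a in Set.Ioc 0 x, F s a := by
    intro s hs
    rw [Set.uIcc_of_le hx] at hs
    rw [intervalIntegral.integral_of_le hs.1, MeasureTheory.integral_Ioc_eq_integral_Ioo]
    have : ∀ a, F s a = Set.indicator (Set.Iio s) (fun a => f a s) a := fun a => by
      simp [F, Set.indicator]
    simp_rw [this]
    rw [MeasureTheory.setIntegral_indicator measurableSet_Iio]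
    congr 2
    ext a
    simp only [Set.mem_Ioo, Set.mem_inter_iff, Set.mem_Ioc, Set.mem_Iio]
    constructor
    · rintro ⟨h1, h2⟩; exact ⟨⟨h1, h2.le.trans hs.2⟩, h2⟩
    · rintro ⟨⟨h1, _⟩, h2⟩; exact ⟨h1, h2⟩
  have h2 : ∀ a ∈ Set.uIcc 0 x, ∫ s in a..x, f a s = ∫ s in Set.Ioc 0 x, F s a := by
    intro a ha
    rw [Set.uIcc_of_le hx] at ha
    rw [intervalIntegral.integral_of_le ha.2]
    have : ∀ s, F s a = Set.indicator (Set.Ioi a) (fun s => f a s) s := fun s => by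
      simp [F, Set.indicator]
    simp_rw [this]
    rw [MeasureTheory.setIntegral_indicator measurableSet_Ioi]
    congr 2
    ext s
    simp only [Set.mem_inter_iff, Set.mem_Ioc, Set.mem_Ioi]
    constructor
    · rintro ⟨h1, h2⟩; exact ⟨⟨ha.1.trans_lt h1, h2⟩, h1⟩
    · rintro ⟨⟨_, h1⟩, h2⟩; exact ⟨h2, h1⟩
  rw [intervalIntegral.integral_congr h1, intervalIntegral.integral_congr h2,
    intervalIntegral.integral_of_le hx, intervalIntegral.integral_of_le hx]
  refine MeasureTheory.integral_integral_swap ?_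
  rw [MeasureTheory.Measure.prod_restrict]
  have hI : MeasureTheory.IntegrableOn (fun p : ℝ × ℝ => f p.2 p.1) (Set.Ioc 0 x ×ˢ Set.Ioc 0 x)
      (MeasureTheory.volume.prod MeasureTheory.volume) := by
    refine MeasureTheory.IntegrableOn.mono_set (t := Set.Icc 0 x ×ˢ Set.Icc 0 x) ?_
      (Set.prod_mono Set.Ioc_subset_Icc_self Set.Ioc_subset_Icc_self)
    exact Continuous.continuousOn (by fun_prop) |>.integrableOn_compact (isCompact_Icc.prod isCompact_Icc)
  exact hI.indicator (measurableSet_lt measurable_snd measurable_fst)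

/-- Integration against exp(ct) gains a factor 1/c: this makes Volterra operators contractive in
weighted norms, and the integral term of the characteristic function negligible on the imaginary
axis. -/
theorem norm_integral_le_exp_mul {f : ℝ → ℂ} {C c x : ℝ} (hc : 0 < c) (hC : 0 ≤ C) (hx : 0 ≤ x)
    (hf : ∀ t ∈ Set.Ioc 0 x, ‖f t‖ ≤ C * Real.exp (c * t)) :
    ‖∫ t in (0 : ℝ)..x, f t‖ ≤ C / c * Real.exp (c * x) := by
  have h1 : ‖∫ t in (0 : ℝ)..x, f t‖ ≤ ∫ t in (0 : ℝ)..x, C * Real.exp (c * t) :=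
    intervalIntegral.norm_integral_le_of_norm_le hx (Filter.Eventually.of_forall hf)
      (Continuous.intervalIntegrable (by fun_prop) _ _)
  have h2 : ∫ t in (0 : ℝ)..x, C * Real.exp (c * t) =
      C / c * Real.exp (c * x) - C / c * Real.exp (c * 0) := by
    refine intervalIntegral.integral_eq_sub_of_hasDerivAt
      (f := fun t => C / c * Real.exp (c * t)) (fun t _ => ?_)
      (Continuous.intervalIntegrable (by fun_prop) _ _)
    have := (((hasDerivAt_id t).const_mul c).exp).const_mul (C / c)
    simp only [id_eq, mul_one] at this
    have he : C / c * (Real.exp (c * t) * c) = C * Real.exp (c * t) := by field_simp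
    rwa [he] at this
  rw [h2, mul_zero, Real.exp_zero] at h1
  have : 0 ≤ C / c := by positivity
  linarith

theorem continuous_integral_of_continuous {X : Type*} [TopologicalSpace X] {f : X → ℝ → ℂ}
    (hf : Continuous fun p : X × ℝ => f p.1 p.2) {s : X → ℝ} (hs : Continuous s) :
    Continuous fun x => ∫ t in (0 : ℝ)..s x, f x t :=
  intervalIntegral.continuous_parametric_intervalIntegral_of_continuous (f := f) hf hs

theorem exists_norm_le_on_square {M : ℝ → ℝ → ℂ} (hM : Continuous fun p : ℝ × ℝ => M p.1 p.2)
    (A : ℝ) : ∃ C, 0 ≤ C ∧ ∀ x ∈ Set.Icc 0 A, ∀ t ∈ Set.Icc 0 A, ‖M x t‖ ≤ C := by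
  obtain ⟨C, hC⟩ := ((isCompact_Icc (a := (0 : ℝ)) (b := A)).prod
    (isCompact_Icc (a := (0 : ℝ)) (b := A))).exists_bound_of_continuousOn hM.continuousOn
  exact ⟨max C 0, le_max_right _ _, fun x hx t ht => (hC (x, t) ⟨hx, ht⟩).trans (le_max_left _ _)⟩

/-! ### The transmutation operator -/

/-- In the coordinates `a = x - t`, `t`, the kernel `K(x, t) = h (x - t) t` of the operator
`g ↦ g + ∫₀ˣ K(x, t) g(t) dt` intertwining `i d/dx` with the integro-differential expression. -/
structure IsTransmutationKernel (M h k : ℝ → ℝ → ℂ) : Prop where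
  continuous_h : Continuous fun p : ℝ × ℝ => h p.1 p.2
  continuous_k : Continuous fun p : ℝ × ℝ => k p.1 p.2
  h_eq : ∀ a s, h a s = ∫ τ in (0 : ℝ)..s, k a τ
  k_eq : ∀ a ∈ Set.Icc 0 π, ∀ τ ∈ Set.Icc 0 π,
    k a τ = Complex.I * (M (a + τ) τ + ∫ b in (0 : ℝ)..a, M (a + τ) (τ + b) * h b τ)

/-- Substituting `k_eq` into `h_eq` gives a fixed-point equation for h, integrated over [0,s] in the
second variable. For g(a,s) = exp(-cs) h(a,s) it is a contraction in the sup norm when c is large.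
-/
theorem exists_isTransmutationKernel {M : ℝ → ℝ → ℂ}
    (hM : Continuous fun p : ℝ × ℝ => M p.1 p.2) : ∃ h k, IsTransmutationKernel M h k := by
  obtain ⟨C, hC0, hC⟩ := exists_norm_le_on_square hM (2 * π)
  -- The contraction constant is Cπ/c, so this c makes it at most 1/2. The bound C is taken on [0,
  -- 2π]² because M is evaluated at a + τ with a, τ ≤ π.
  set c : ℝ := 2 * (C * π + 1) with hc
  have hπ := Real.pi_pos
  have hc0 : 0 < c := by positivity
  let kk : (ℝ → ℝ → ℂ) → ℝ → ℝ → ℂ := fun h a τ =>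
    Complex.I * (M (a + τ) τ + ∫ b in (0 : ℝ)..a, M (a + τ) (τ + b) * h b τ)
  have hkk : ∀ h : ℝ → ℝ → ℂ, (Continuous fun p : ℝ × ℝ => h p.1 p.2) →
      Continuous fun p : ℝ × ℝ => kk h p.1 p.2 := by
    intro h hh
    have := continuous_integral_of_continuous (X := ℝ × ℝ)
      (f := fun p b => M (p.1 + p.2) (p.2 + b) * h b p.2) (by fun_prop) continuous_fst
    have h2 : Continuous fun p : ℝ × ℝ => M (p.1 + p.2) p.2 := by fun_prop
    exact continuous_const.mul (h2.add this)
  let Φ₀ : (ℝ → ℝ → ℂ) → ℝ → ℝ → ℂ := fun g a s =>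
    Real.exp (-(c * s)) * ∫ τ in (0 : ℝ)..s, kk (fun b τ => Real.exp (c * τ) * g b τ) a τ
  have hΦ₀ : ∀ g : ℝ → ℝ → ℂ, (Continuous fun p : ℝ × ℝ => g p.1 p.2) →
      Continuous fun p : ℝ × ℝ => Φ₀ g p.1 p.2 := by
    intro g hg
    have h1 := hkk (fun b τ => Real.exp (c * τ) * g b τ) (by fun_prop)
    have h2 := continuous_integral_of_continuous (X := ℝ × ℝ)
      (f := fun p τ => kk (fun b τ => Real.exp (c * τ) * g b τ) p.1 τ) (s := Prod.snd)
      (h1.comp (by fun_prop : Continuous fun q : (ℝ × ℝ) × ℝ => (q.1.1, q.2))) continuous_snd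
    have h3 : Continuous fun p : ℝ × ℝ => (Real.exp (-(c * p.2)) : ℂ) := by fun_prop
    exact h3.mul h2
  -- Clamping both arguments to [0,π] makes the iterate bounded on the whole plane, so that the
  -- complete space of bounded continuous functions can be used.
  let cl : ℝ → ℝ := fun x => max 0 (min x π)
  have hcl : ∀ x, cl x ∈ Set.Icc 0 π := fun x =>
    ⟨le_max_left _ _, max_le hπ.le (min_le_right _ _)⟩
  have hclc : Continuous cl := by fun_prop
  have hcl_eq : ∀ x ∈ Set.Icc 0 π, cl x = x := fun x hx => by
    simp only [cl, min_eq_left hx.2, max_eq_right hx.1]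
  have hex : ∀ g : BoundedContinuousFunction (ℝ × ℝ) ℂ, ∃ G : BoundedContinuousFunction (ℝ × ℝ) ℂ,
      ∀ p, G p = Φ₀ (fun a s => g (a, s)) (cl p.1) (cl p.2) := by
    intro g
    have h1 := hΦ₀ (fun a s => g (a, s)) (by fun_prop)
    obtain ⟨D, -, hD⟩ := exists_norm_le_on_square h1 π
    exact ⟨BoundedContinuousFunction.ofNormedAddCommGroup
      (fun p => Φ₀ (fun a s => g (a, s)) (cl p.1) (cl p.2))
      (h1.comp (by fun_prop : Continuous fun p : ℝ × ℝ => (cl p.1, cl p.2))) D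
      (fun p => hD _ (hcl _) _ (hcl _)), fun p => rfl⟩
  choose Φ hΦ using hex
  have hcontr : ContractingWith (1 / 2) Φ := by
    refine ⟨by rw [← NNReal.coe_lt_coe]; norm_num, LipschitzWith.of_dist_le_mul fun g g' => ?_⟩
    rw [BoundedContinuousFunction.dist_le (by positivity)]
    rintro ⟨a, s⟩
    rw [hΦ, hΦ, dist_eq_norm]
    set d := dist g g' with hd
    have hd0 : 0 ≤ d := dist_nonneg
    obtain ⟨ha0, ha1⟩ := hcl a
    obtain ⟨hs0, hs1⟩ := hcl s
    simp only
    set a' := cl a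
    set s' := cl s
    have hK : ∀ τ ∈ Set.Ioc 0 s',
        ‖kk (fun b τ => Real.exp (c * τ) * g (b, τ)) a' τ -
          kk (fun b τ => Real.exp (c * τ) * g' (b, τ)) a' τ‖ ≤ C * d * π * Real.exp (c * τ) := by
      intro τ hτ
      have hsub : kk (fun b τ => Real.exp (c * τ) * g (b, τ)) a' τ -
          kk (fun b τ => Real.exp (c * τ) * g' (b, τ)) a' τ =
          Complex.I * ∫ b in (0 : ℝ)..a', M (a' + τ) (τ + b) *
            (Real.exp (c * τ) * (g (b, τ) - g' (b, τ))) := by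
        simp only [kk]
        rw [← mul_sub, add_sub_add_left_eq_sub, ← intervalIntegral.integral_sub
          (Continuous.intervalIntegrable (by fun_prop) _ _)
          (Continuous.intervalIntegrable (by fun_prop) _ _)]
        congr 2
        funext b
        ring
      rw [hsub, norm_mul, Complex.norm_I, one_mul]
      have h1 := intervalIntegral.norm_integral_le_of_norm_le_const (a := 0) (b := a')
        (f := fun b => M (a' + τ) (τ + b) * (Real.exp (c * τ) * (g (b, τ) - g' (b, τ))))
        (C := C * (Real.exp (c * τ) * d)) (fun b hb => by
          rw [Set.uIoc_of_le ha0] at hb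
          rw [norm_mul, norm_mul, Complex.norm_real, Real.norm_of_nonneg (Real.exp_pos _).le]
          have h1 : ‖g (b, τ) - g' (b, τ)‖ ≤ d := by
            rw [← dist_eq_norm]; exact BoundedContinuousFunction.dist_coe_le_dist _
          have h2 : ‖M (a' + τ) (τ + b)‖ ≤ C :=
            hC _ ⟨by linarith [hτ.1], by linarith [hτ.2]⟩ _
              ⟨by linarith [hτ.1, hb.1], by linarith [hτ.2, hb.2]⟩
          gcongr)
      rw [sub_zero, abs_of_nonneg ha0] at h1
      calc _ ≤ C * (Real.exp (c * τ) * d) * a' := h1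
        _ ≤ C * (Real.exp (c * τ) * d) * π := by gcongr
        _ = _ := by ring
    have hdiff : Φ₀ (fun a s => g (a, s)) a' s' - Φ₀ (fun a s => g' (a, s)) a' s' =
        Real.exp (-(c * s')) * ∫ τ in (0 : ℝ)..s',
          (kk (fun b τ => Real.exp (c * τ) * g (b, τ)) a' τ -
            kk (fun b τ => Real.exp (c * τ) * g' (b, τ)) a' τ) := by
      have hi : ∀ g : BoundedContinuousFunction (ℝ × ℝ) ℂ, IntervalIntegrable
          (fun τ => kk (fun b τ => Real.exp (c * τ) * g (b, τ)) a' τ) MeasureTheory.volume 0 s' := by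
        intro g
        have h1 := hkk (fun b τ => Real.exp (c * τ) * g (b, τ)) (by fun_prop)
        exact Continuous.intervalIntegrable
          (h1.comp (by fun_prop : Continuous fun τ : ℝ => (a', τ))) _ _
      rw [intervalIntegral.integral_sub (hi g) (hi g'), mul_sub]
    have hle := norm_integral_le_exp_mul hc0 (by positivity) hs0 hK
    rw [hdiff, norm_mul, Complex.norm_real, Real.norm_of_nonneg (Real.exp_pos _).le]
    calc _ ≤ Real.exp (-(c * s')) * (C * d * π / c * Real.exp (c * s')) := by gcongr
      _ = C * d * π / c := by
          rw [mul_left_comm, ← Real.exp_add]; simp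
      _ ≤ ((1 / 2 : NNReal) : ℝ) * d := by
          rw [div_le_iff₀ hc0, hc]
          push_cast
          nlinarith
  have hfix := hcontr.fixedPoint_isFixedPt
  set g := ContractingWith.fixedPoint Φ hcontr
  let h₀ : ℝ → ℝ → ℂ := fun a s => Real.exp (c * s) * g (a, s)
  have hh₀ : Continuous fun p : ℝ × ℝ => h₀ p.1 p.2 := by simp only [h₀]; fun_prop
  have hk := hkk h₀ hh₀
  have hh₀_eq : ∀ a ∈ Set.Icc 0 π, ∀ s ∈ Set.Icc 0 π, h₀ a s = ∫ τ in (0 : ℝ)..s, kk h₀ a τ := by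
    intro a ha s hs
    have h1 : g (a, s) = Real.exp (-(c * s)) * ∫ τ in (0 : ℝ)..s, kk h₀ a τ := by
      have := hΦ g (a, s)
      rwa [hfix, hcl_eq a ha, hcl_eq s hs] at this
    calc h₀ a s = Real.exp (c * s) * (Real.exp (-(c * s)) * ∫ τ in (0 : ℝ)..s, kk h₀ a τ) := by
          rw [← h1]
      _ = _ := by rw [← mul_assoc, ← Complex.ofReal_mul, ← Real.exp_add]; simp
  -- The fixed point satisfies the equation only on [0,π]². Redefining h as the integral makes
  -- `h_eq` hold everywhere; `k_eq` survives because it involves h only inside the square.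
  refine ⟨fun a s => ∫ τ in (0 : ℝ)..s, kk h₀ a τ, kk h₀, ?_, hk, fun _ _ => rfl, ?_⟩
  · exact continuous_integral_of_continuous (X := ℝ × ℝ) (f := fun p τ => kk h₀ p.1 τ)
      (s := Prod.snd) (hk.comp (by fun_prop : Continuous fun q : (ℝ × ℝ) × ℝ => (q.1.1, q.2)))
      continuous_snd
  · intro a ha τ hτ
    simp only [kk]
    congr 2
    refine intervalIntegral.integral_congr fun b hb => ?_
    rw [Set.uIcc_of_le ha.1] at hb
    rw [hh₀_eq b ⟨hb.1, hb.2.trans ha.2⟩ τ hτ]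

/-- The transmutation operator with kernel `K(x, t) = h (x - t) t`. -/
noncomputable def transmute (h : ℝ → ℝ → ℂ) (g : ℝ → ℂ) (x : ℝ) : ℂ :=
  g x + ∫ t in (0 : ℝ)..x, h (x - t) t * g t

theorem transmute_zero (h : ℝ → ℝ → ℂ) (g : ℝ → ℂ) : transmute h g 0 = g 0 := by
  simp [transmute]

theorem transmute_const_mul (h : ℝ → ℝ → ℂ) (g : ℝ → ℂ) (c : ℂ) (x : ℝ) :
    transmute h (fun t => c * g t) x = c * transmute h g x := by
  simp only [transmute, mul_add, ← intervalIntegral.integral_const_mul]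
  congr 2
  funext t
  ring

theorem transmute_add {h : ℝ → ℝ → ℂ} (hh : Continuous fun p : ℝ × ℝ => h p.1 p.2)
    {f g : ℝ → ℂ} (hf : Continuous f) (hg : Continuous g) (x : ℝ) :
    transmute h (fun t => f t + g t) x = transmute h f x + transmute h g x := by
  simp only [transmute, mul_add]
  rw [intervalIntegral.integral_add (Continuous.intervalIntegrable (by fun_prop) _ _)
    (Continuous.intervalIntegrable (by fun_prop) _ _)]
  ring

theorem IsTransmutationKernel.hasDerivAt {M h k : ℝ → ℝ → ℂ}
    (hh : IsTransmutationKernel M h k) (a s : ℝ) : HasDerivAt (fun s => h a s) (k a s) s := by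
  have hk := hh.continuous_k
  have h1 : (fun s => h a s) = fun s => ∫ τ in (0 : ℝ)..s, k a τ := funext (hh.h_eq a)
  rw [h1]
  exact ((by fun_prop : Continuous fun τ => k a τ).integral_hasStrictDerivAt 0 s).hasDerivAt

/-- Exhibits the Volterra term as a primitive in x, so that it can be differentiated although h is
only known to be differentiable in its second variable. For fixed a, h(a, x-a) g(x-a) is the
integral of its derivative from s = a, where h(a,0) = 0; then the order of integration is exchanged.
-/
theorem integral_kernel_mul_eq {M h k : ℝ → ℝ → ℂ} (hh : IsTransmutationKernel M h k)
    {g g' : ℝ → ℂ} (hg : ∀ x, HasDerivAt g (g' x) x) (hg' : Continuous g') {x : ℝ}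
    (hx : 0 ≤ x) : ∫ t in (0 : ℝ)..x, h (x - t) t * g t =
      ∫ s in (0 : ℝ)..x, ∫ t in (0 : ℝ)..s, (k (s - t) t * g t + h (s - t) t * g' t) := by
  have hgc : Continuous g := continuous_iff_continuousAt.2 fun x => (hg x).continuousAt
  have hhc := hh.continuous_h
  have hkc := hh.continuous_k
  have hrefl : ∀ (f : ℝ → ℝ → ℂ) (y : ℝ), ∫ t in (0 : ℝ)..y, f (y - t) t =
      ∫ a in (0 : ℝ)..y, f a (y - a) := fun f y => by
    have := intervalIntegral.integral_comp_sub_left (a := 0) (b := y) (fun a => f a (y - a)) y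
    simpa using this
  have hparts : ∀ a, h a (x - a) * g (x - a) =
      ∫ s in a..x, (k a (s - a) * g (s - a) + h a (s - a) * g' (s - a)) := by
    intro a
    have h1 : ∫ τ in (0 : ℝ)..(x - a), (k a τ * g τ + h a τ * g' τ) =
        h a (x - a) * g (x - a) - h a 0 * g 0 :=
      intervalIntegral.integral_eq_sub_of_hasDerivAt
        (fun τ _ => (hh.hasDerivAt a τ).mul (hg τ))
        (Continuous.intervalIntegrable (by fun_prop) _ _)
    have h2 : h a 0 = 0 := by rw [hh.h_eq]; simp
    rw [intervalIntegral.integral_comp_sub_right (fun τ => k a τ * g τ + h a τ * g' τ) a,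
      sub_self, h1, h2]
    ring
  rw [hrefl (fun a t => h a t * g t) x]
  simp_rw [hparts]
  rw [← integral_triangle_swap (f := fun a s => k a (s - a) * g (s - a) + h a (s - a) * g' (s - a))
    (by fun_prop) hx]
  congr 1
  funext s
  exact (hrefl (fun a t => k a t * g t + h a t * g' t) s).symm

/-- This is where the equation for k is used: after exchanging the integrals, its two terms assemble
into g and the Volterra part of `transmute h g`. -/
theorem integral_deriv_kernel_eq {M h k : ℝ → ℝ → ℂ}
    (hM : Continuous fun p : ℝ × ℝ => M p.1 p.2) (hh : IsTransmutationKernel M h k)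
    {g : ℝ → ℂ} {x : ℝ} (hx : x ∈ Set.Icc 0 π) (hgc : Continuous g) :
    ∫ t in (0 : ℝ)..x, k (x - t) t * g t =
      Complex.I * ∫ t in (0 : ℝ)..x, M x t * transmute h g t := by
  have hhc := hh.continuous_h
  have h1 : ∀ t ∈ Set.uIcc 0 x, k (x - t) t * g t =
      Complex.I * (M x t * g t + ∫ s in t..x, M x s * (h (s - t) t * g t)) := by
    intro t ht
    rw [Set.uIcc_of_le hx.1] at ht
    rw [hh.k_eq (x - t) ⟨by linarith [ht.2], by linarith [ht.1, hx.2]⟩ t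
      ⟨ht.1, ht.2.trans hx.2⟩, sub_add_cancel]
    have h2 : ∫ b in (0 : ℝ)..(x - t), M x (t + b) * h b t = ∫ s in t..x, M x s * h (s - t) t := by
      have := intervalIntegral.integral_comp_sub_right (a := t) (b := x)
        (fun b => M x (t + b) * h b t) t
      simp only [add_sub_cancel, sub_self] at this
      exact this.symm
    have h3 : ∫ s in t..x, M x s * (h (s - t) t * g t) = (∫ s in t..x, M x s * h (s - t) t) * g t := by
      rw [← intervalIntegral.integral_mul_const]
      simp only [mul_assoc]
    rw [h2, h3]
    ring
  have hc1 : Continuous fun t => ∫ s in t..x, M x s * (h (s - t) t * g t) := by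
    have : ∀ t, ∫ s in t..x, M x s * (h (s - t) t * g t) =
        (∫ s in (0 : ℝ)..x, M x s * (h (s - t) t * g t)) -
          ∫ s in (0 : ℝ)..t, M x s * (h (s - t) t * g t) := fun t =>
      (intervalIntegral.integral_interval_sub_left (Continuous.intervalIntegrable (by fun_prop) _ _)
        (Continuous.intervalIntegrable (by fun_prop) _ _)).symm
    simp_rw [this]
    have hf : Continuous fun p : ℝ × ℝ => M x p.2 * (h (p.2 - p.1) p.1 * g p.1) := by fun_prop
    exact (continuous_integral_of_continuous (X := ℝ)
      (f := fun t s => M x s * (h (s - t) t * g t)) hf continuous_const).sub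
      (continuous_integral_of_continuous (X := ℝ)
      (f := fun t s => M x s * (h (s - t) t * g t)) hf continuous_id)
  rw [intervalIntegral.integral_congr h1, intervalIntegral.integral_const_mul,
    intervalIntegral.integral_add (Continuous.intervalIntegrable (by fun_prop) _ _)
      (hc1.intervalIntegrable _ _),
    ← integral_triangle_swap (f := fun t s => M x s * (h (s - t) t * g t)) (by fun_prop) hx.1]
  have hc2 : Continuous fun s => ∫ t in (0 : ℝ)..s, M x s * (h (s - t) t * g t) :=
    continuous_integral_of_continuous (X := ℝ)
      (f := fun s t => M x s * (h (s - t) t * g t)) (by fun_prop) continuous_id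
  rw [← intervalIntegral.integral_add (Continuous.intervalIntegrable (by fun_prop) _ _)
    (hc2.intervalIntegrable _ _)]
  congr 2
  funext s
  rw [transmute, mul_add, intervalIntegral.integral_const_mul]

/-- The transmutation operator intertwines `i d/dx` with the integro-differential expression. -/
theorem hasDerivWithinAt_transmute {M h k : ℝ → ℝ → ℂ}
    (hM : Continuous fun p : ℝ × ℝ => M p.1 p.2) (hh : IsTransmutationKernel M h k)
    {g g' : ℝ → ℂ} (hg : ∀ x, HasDerivAt g (g' x) x) (hg' : Continuous g')
    {x : ℝ} (hx : x ∈ Set.Icc 0 π) :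
    HasDerivWithinAt (transmute h g) (transmute h g' x +
      Complex.I * ∫ t in (0 : ℝ)..x, M x t * transmute h g t) (Set.Icc 0 π) x := by
  have hgc : Continuous g := continuous_iff_continuousAt.2 fun x => (hg x).continuousAt
  have hhc := hh.continuous_h
  have hkc := hh.continuous_k
  let ρ : ℝ → ℂ := fun s => ∫ t in (0 : ℝ)..s, (k (s - t) t * g t + h (s - t) t * g' t)
  have hρ : Continuous ρ := continuous_integral_of_continuous (X := ℝ)
    (f := fun s t => k (s - t) t * g t + h (s - t) t * g' t) (by fun_prop) continuous_id
  have h1 : HasDerivAt (fun y => g y + ∫ s in (0 : ℝ)..y, ρ s) (g' x + ρ x) x :=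
    (hg x).add (hρ.integral_hasStrictDerivAt 0 x).hasDerivAt
  have h2 : ρ x = (∫ t in (0 : ℝ)..x, k (x - t) t * g t) + ∫ t in (0 : ℝ)..x, h (x - t) t * g' t :=
    intervalIntegral.integral_add (Continuous.intervalIntegrable (by fun_prop) _ _)
      (Continuous.intervalIntegrable (by fun_prop) _ _)
  have h3 : g' x + ρ x = transmute h g' x +
      Complex.I * ∫ t in (0 : ℝ)..x, M x t * transmute h g t := by
    rw [h2, integral_deriv_kernel_eq hM hh hx hgc, transmute]
    ring
  rw [← h3]
  refine h1.hasDerivWithinAt.congr (fun y hy => ?_) ?_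
  · rw [transmute, integral_kernel_mul_eq hh hg hg' hy.1]
  · rw [transmute, integral_kernel_mul_eq hh hg hg' hx.1]

/-! ### Uniqueness for the initial value problem -/

/-- A Grönwall substitute: a bound that always improves by a factor 2 forces Q₀/2ⁿ → 0. With w an
exponential weight it serves both Volterra uniqueness arguments below. -/
theorem le_zero_of_forall_halving {ι : Type*} {q w : ι → ℝ} {Q₀ : ℝ} (hQ₀ : 0 ≤ Q₀)
    (h0 : ∀ i, q i ≤ Q₀ * w i)
    (h : ∀ Q, 0 ≤ Q → (∀ i, q i ≤ Q * w i) → ∀ i, q i ≤ Q / 2 * w i) (i : ι) : q i ≤ 0 := by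
  have hn : ∀ n : ℕ, ∀ i, q i ≤ Q₀ / 2 ^ n * w i := by
    intro n
    induction n with
    | zero => simpa using h0
    | succ n ih =>
      intro i
      have := h _ (by positivity) ih i
      rwa [div_div, ← pow_succ] at this
  have hlim : Filter.Tendsto (fun n : ℕ => Q₀ * (1 / 2) ^ n * w i) Filter.atTop
      (nhds (Q₀ * 0 * w i)) :=
    ((tendsto_pow_atTop_nhds_zero_of_lt_one (by norm_num) (by norm_num)).const_mul _).mul_const _
  rw [mul_zero, zero_mul] at hlim
  refine ge_of_tendsto' hlim fun n => ?_
  have := hn n i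
  rwa [one_div, inv_pow, ← div_eq_mul_inv]

theorem integroDiff_congr {M : ℝ → ℝ → ℂ} {y z : ℝ → ℂ} (h : ∀ x ∈ Set.Icc 0 π, y x = z x) {x : ℝ}
    (hx : x ∈ Set.Icc 0 π) : integroDiff M y x = integroDiff M z x := by
  unfold integroDiff
  rw [derivWithin_congr h (h x hx)]
  congr 1
  refine intervalIntegral.integral_congr fun t ht => ?_
  rw [Set.uIcc_of_le hx.1] at ht
  rw [h t ⟨ht.1, ht.2.trans hx.2⟩]

theorem integroDiff_sub {M : ℝ → ℝ → ℂ} (hM : Continuous fun p : ℝ × ℝ => M p.1 p.2)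
    {y z : ℝ → ℂ} (hy : DifferentiableOn ℝ y (Set.Icc 0 π))
    (hz : DifferentiableOn ℝ z (Set.Icc 0 π)) {x : ℝ} (hx : x ∈ Set.Icc 0 π) :
    integroDiff M (fun t => y t - z t) x = integroDiff M y x - integroDiff M z x := by
  have hint : ∀ {u : ℝ → ℂ}, DifferentiableOn ℝ u (Set.Icc 0 π) →
      IntervalIntegrable (fun t => M x t * u t) MeasureTheory.volume 0 x := by
    intro u hu
    refine ContinuousOn.intervalIntegrable ?_
    rw [Set.uIcc_of_le hx.1]
    exact (by fun_prop : Continuous fun t => M x t).continuousOn.mul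
      (hu.continuousOn.mono (Set.Icc_subset_Icc_right hx.2))
  unfold integroDiff
  rw [derivWithin_fun_sub (hy x hx) (hz x hx)]
  simp only [mul_sub]
  rw [intervalIntegral.integral_sub (hint hy) (hint hz)]
  ring

theorem eq_zero_of_integroDiff_eq {M : ℝ → ℝ → ℂ} (hM : Continuous fun p : ℝ × ℝ => M p.1 p.2)
    {y : ℝ → ℂ} {μ : ℂ} (hy : DifferentiableOn ℝ y (Set.Icc 0 π)) (hy0 : y 0 = 0)
    (h : ∀ x ∈ Set.Icc 0 π, integroDiff M y x = μ * y x) : ∀ x ∈ Set.Icc 0 π, y x = 0 := by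
  obtain ⟨C, hC0, hC⟩ := exists_norm_le_on_square hM π
  have hπ := Real.pi_pos
  obtain ⟨Q₀, hQ₀⟩ := isCompact_Icc.exists_bound_of_continuousOn hy.continuousOn
  -- If ‖y‖ ≤ Q exp(cx), the equation gives ‖y'‖ ≤ (‖μ‖ + Cπ) Q exp(cx), which is at most the
  -- derivative of (Q/2) exp(cx) for this c.
  set c : ℝ := 2 * (‖μ‖ + C * π + 1) with hc
  have hc0 : 0 < c := by positivity
  have hhalf := le_zero_of_forall_halving (ι := Set.Icc 0 π) (q := fun x => ‖y x‖)
    (w := fun x => Real.exp (c * x)) (Q₀ := max Q₀ 0) (le_max_right _ _) (fun x => by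
      have h1 := (hQ₀ x x.2).trans (le_max_left _ 0)
      have h2 : 1 ≤ Real.exp (c * x) := Real.one_le_exp (mul_nonneg hc0.le x.2.1)
      nlinarith [le_max_right Q₀ 0]) (fun Q hQ hyQ => by
      rintro ⟨x, hx⟩
      refine image_norm_le_of_norm_deriv_right_le_deriv_boundary
        (f' := derivWithin y (Set.Icc 0 π)) (B := fun x => Q / 2 * Real.exp (c * x))
        (B' := fun x => Q / 2 * (Real.exp (c * x) * c)) hy.continuousOn (fun t ht => ?_)
        (by rw [hy0, norm_zero]; positivity) (fun t => ?_) (fun t ht => ?_) hx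
      · exact ((hy t ⟨ht.1, ht.2.le⟩).hasDerivWithinAt).mono_of_mem_nhdsWithin
          (Icc_mem_nhdsGE_of_mem ht)
      · have := (((hasDerivAt_id t).const_mul c).exp).const_mul (Q / 2)
        simpa using this
      · have ht' : t ∈ Set.Icc 0 π := ⟨ht.1, ht.2.le⟩
        have h1 : Complex.I * derivWithin y (Set.Icc 0 π) t =
            μ * y t - ∫ s in (0 : ℝ)..t, M t s * y s := by
          rw [← h t ht', integroDiff]; ring
        have h2 : ‖derivWithin y (Set.Icc 0 π) t‖ =
            ‖μ * y t - ∫ s in (0 : ℝ)..t, M t s * y s‖ := by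
          rw [← h1, norm_mul, Complex.norm_I, one_mul]
        have h3 : ‖∫ s in (0 : ℝ)..t, M t s * y s‖ ≤ C * (Q * Real.exp (c * t)) * |t - 0| := by
          refine intervalIntegral.norm_integral_le_of_norm_le_const fun s hs => ?_
          rw [Set.uIoc_of_le ht.1] at hs
          have hs' : s ∈ Set.Icc 0 π := ⟨hs.1.le, hs.2.trans ht.2.le⟩
          have h4 : ‖y s‖ ≤ Q * Real.exp (c * s) := hyQ ⟨s, hs'⟩
          have h5 : Real.exp (c * s) ≤ Real.exp (c * t) := by
            gcongr; exact hs.2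
          have h6 := hC t ht' s hs'
          rw [norm_mul]
          gcongr
          exact h4.trans (by gcongr)
        rw [sub_zero, abs_of_nonneg ht.1] at h3
        have h4 : ‖y t‖ ≤ Q * Real.exp (c * t) := hyQ ⟨t, ht'⟩
        rw [h2]
        calc _ ≤ ‖μ * y t‖ + ‖∫ s in (0 : ℝ)..t, M t s * y s‖ := norm_sub_le _ _
          _ ≤ ‖μ‖ * (Q * Real.exp (c * t)) + C * (Q * Real.exp (c * t)) * π := by
              rw [norm_mul]
              gcongr
              exact h3.trans (by gcongr; exact ht.2.le)
          _ ≤ Q / 2 * (Real.exp (c * t) * c) := by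
              rw [hc]
              have : 0 ≤ Q * Real.exp (c * t) := by positivity
              nlinarith)
  exact fun x hx => norm_le_zero_iff.1 (hhalf ⟨x, hx⟩)

/-! ### Root functions and algebraic multiplicity -/

/-- The combination of the functions `(-ix)ʲ / j! * exp (-iμx)`, `j < n`, with coefficients `c`. -/
noncomputable def expPoly (μ : ℂ) (n : ℕ) (c : ℕ → ℂ) (x : ℝ) : ℂ :=
  (∑ j ∈ Finset.range n, c j * ((-Complex.I * x) ^ j / (j.factorial : ℂ))) *
    Complex.exp (-Complex.I * μ * x)

theorem continuous_expPoly (μ : ℂ) (n : ℕ) (c : ℕ → ℂ) : Continuous (expPoly μ n c) := by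
  unfold expPoly
  fun_prop

theorem hasDerivAt_expPoly_succ (μ : ℂ) (n : ℕ) (c : ℕ → ℂ) (x : ℝ) :
    HasDerivAt (expPoly μ (n + 1) c) (-Complex.I * (expPoly μ n (fun j => c (j + 1)) x +
      μ * expPoly μ (n + 1) c x)) x := by
  have hx : HasDerivAt (fun x : ℝ => (x : ℂ)) 1 x := (hasDerivAt_id x).ofReal_comp
  have h1 : HasDerivAt (fun x : ℝ => Complex.exp (-Complex.I * μ * x))
      (Complex.exp (-Complex.I * μ * x) * (-Complex.I * μ * 1)) x := (hx.const_mul _).cexp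
  have h2 : ∀ j : ℕ, HasDerivAt
      (fun x : ℝ => c (j + 1) * ((-Complex.I * x) ^ (j + 1) / ((j + 1).factorial : ℂ)))
      (-Complex.I * (c (j + 1) * ((-Complex.I * x) ^ j / (j.factorial : ℂ)))) x := by
    intro j
    have h3 := ((((hx.const_mul (-Complex.I)).pow (j + 1)).div_const
      ((j + 1).factorial : ℂ)).const_mul (c (j + 1)))
    refine h3.congr_deriv ?_
    have h4 : (j.factorial : ℂ) ≠ 0 := by exact_mod_cast j.factorial_ne_zero
    have h5 : ((j : ℂ) + 1) ≠ 0 := by exact_mod_cast j.succ_ne_zero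
    rw [Nat.factorial_succ]
    push_cast
    field_simp
  have h3 : HasDerivAt
      (fun x : ℝ => ∑ j ∈ Finset.range (n + 1), c j * ((-Complex.I * x) ^ j / (j.factorial : ℂ)))
      (∑ j ∈ Finset.range n, -Complex.I * (c (j + 1) * ((-Complex.I * x) ^ j / (j.factorial : ℂ))))
      x := by
    have h4 : (fun x : ℝ => ∑ j ∈ Finset.range (n + 1),
        c j * ((-Complex.I * x) ^ j / (j.factorial : ℂ))) = fun x : ℝ =>
        (∑ j ∈ Finset.range n, c (j + 1) * ((-Complex.I * x) ^ (j + 1) / ((j + 1).factorial : ℂ))) +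
          c 0 := by
      funext x
      rw [Finset.sum_range_succ']
      simp
    rw [h4]
    exact (HasDerivAt.fun_sum fun j _ => h2 j).add_const (c 0)
  refine (h3.mul h1).congr_deriv ?_
  rw [← Finset.mul_sum]
  simp only [expPoly]
  ring

theorem expPoly_zero (μ : ℂ) (c : ℕ → ℂ) (x : ℝ) : expPoly μ 0 c x = 0 := by
  simp [expPoly]

theorem transmute_expPoly_zero (h : ℝ → ℝ → ℂ) (μ : ℂ) (c : ℕ → ℂ) (x : ℝ) :
    transmute h (expPoly μ 0 c) x = 0 := by
  simp [transmute, expPoly_zero]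

theorem transmute_expPoly_succ_at_zero (h : ℝ → ℝ → ℂ) (μ : ℂ) (n : ℕ) (c : ℕ → ℂ) :
    transmute h (expPoly μ (n + 1) c) 0 = c 0 := by
  rw [transmute_zero, expPoly, Finset.sum_range_succ']
  simp

theorem transmute_expPoly_succ {h : ℝ → ℝ → ℂ} (hh : Continuous fun p : ℝ × ℝ => h p.1 p.2)
    (μ : ℂ) (n : ℕ) (c : ℕ → ℂ) (x : ℝ) :
    transmute h (expPoly μ (n + 1) c) x = transmute h (expPoly μ n c) x +
      c n * transmute h (fun t => (-Complex.I * t) ^ n / (n.factorial : ℂ) *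
        Complex.exp (-Complex.I * μ * t)) x := by
  rw [← transmute_const_mul, ← transmute_add hh (continuous_expPoly _ _ _) (by fun_prop)]
  congr 1
  funext t
  simp only [expPoly, Finset.sum_range_succ]
  ring

section

variable {M h k : ℝ → ℝ → ℂ}

theorem hasDerivWithinAt_transmute_expPoly (hM : Continuous fun p : ℝ × ℝ => M p.1 p.2)
    (hh : IsTransmutationKernel M h k) (μ : ℂ) (n : ℕ) (c : ℕ → ℂ) {x : ℝ}
    (hx : x ∈ Set.Icc 0 π) : HasDerivWithinAt (transmute h (expPoly μ (n + 1) c))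
      (-Complex.I * (transmute h (expPoly μ n (fun j => c (j + 1))) x +
        μ * transmute h (expPoly μ (n + 1) c) x -
        ∫ t in (0 : ℝ)..x, M x t * transmute h (expPoly μ (n + 1) c) t)) (Set.Icc 0 π) x := by
  have h1 := continuous_expPoly μ n (fun j => c (j + 1))
  have h2 := continuous_expPoly μ (n + 1) c
  refine (hasDerivWithinAt_transmute hM hh (hasDerivAt_expPoly_succ μ n c) (by fun_prop)
    hx).congr_deriv ?_
  rw [transmute_const_mul, transmute_add hh.continuous_h h1 (by fun_prop), transmute_const_mul]
  ring

theorem differentiableOn_transmute_expPoly (hM : Continuous fun p : ℝ × ℝ => M p.1 p.2)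
    (hh : IsTransmutationKernel M h k) (μ : ℂ) (n : ℕ) (c : ℕ → ℂ) :
    DifferentiableOn ℝ (transmute h (expPoly μ n c)) (Set.Icc 0 π) := by
  cases n with
  | zero =>
    rw [show transmute h (expPoly μ 0 c) = fun _ => 0 from funext (transmute_expPoly_zero h μ c)]
    exact differentiableOn_const _
  | succ n =>
    exact fun x hx => (hasDerivWithinAt_transmute_expPoly hM hh μ n c hx).differentiableWithinAt

theorem integroDiff_transmute_expPoly (hM : Continuous fun p : ℝ × ℝ => M p.1 p.2)
    (hh : IsTransmutationKernel M h k) (μ : ℂ) (n : ℕ) (c : ℕ → ℂ) {x : ℝ}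
    (hx : x ∈ Set.Icc 0 π) : integroDiff M (transmute h (expPoly μ (n + 1) c)) x =
      transmute h (expPoly μ n (fun j => c (j + 1))) x +
        μ * transmute h (expPoly μ (n + 1) c) x := by
  rw [integroDiff, (hasDerivWithinAt_transmute_expPoly hM hh μ n c hx).derivWithin
    (uniqueDiffOn_Icc Real.pi_pos x hx), ← mul_assoc, mul_neg, Complex.I_mul_I]
  ring

/-- The value at 0 reads off c 0, and applying `ℓ - μ` shifts the coefficients down by one. -/
theorem expPoly_coeff_eq_zero (hM : Continuous fun p : ℝ × ℝ => M p.1 p.2)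
    (hh : IsTransmutationKernel M h k) (μ : ℂ) (n : ℕ) (c : ℕ → ℂ)
    (h0 : ∀ x ∈ Set.Icc 0 π, transmute h (expPoly μ n c) x = 0) : ∀ j < n, c j = 0 := by
  induction n generalizing c with
  | zero => intro j hj; omega
  | succ n ih =>
    have hstep : ∀ x ∈ Set.Icc 0 π, transmute h (expPoly μ n (fun j => c (j + 1))) x = 0 := by
      intro x hx
      have h1 := integroDiff_transmute_expPoly hM hh μ n c hx
      rw [integroDiff_congr (z := fun _ => 0) h0 hx, h0 x hx] at h1
      simpa [integroDiff] using h1.symm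
    intro j hj
    cases j with
    | zero =>
      rw [← transmute_expPoly_succ_at_zero h μ n c]
      exact h0 0 ⟨le_rfl, Real.pi_pos.le⟩
    | succ j => exact ih (fun j => c (j + 1)) hstep j (by omega)

/-- Up to the factor `j!`, the derivatives of the characteristic function at `μ`. -/
noncomputable def charCoeff (h : ℝ → ℝ → ℂ) (μ : ℂ) (j : ℕ) : ℂ :=
  transmute h (fun t => (-Complex.I * t) ^ j / (j.factorial : ℂ) *
    Complex.exp (-Complex.I * μ * t)) π

theorem transmute_expPoly_pi {m : ℕ} {μ : ℂ} (hhc : Continuous fun p : ℝ × ℝ => h p.1 p.2)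
    (hm : ∀ j < m, charCoeff h μ j = 0) (c : ℕ → ℂ) (n : ℕ) (hn : n ≤ m) :
    transmute h (expPoly μ n c) π = 0 := by
  induction n with
  | zero => exact transmute_expPoly_zero h μ c π
  | succ n ih =>
    have h1 : transmute h (fun t => (-Complex.I * t) ^ n / (n.factorial : ℂ) *
        Complex.exp (-Complex.I * μ * t)) π = 0 := hm n (by omega)
    rw [transmute_expPoly_succ hhc, ih (by omega), h1, mul_zero, add_zero]

theorem isRootFunction_transmute_expPoly (hM : Continuous fun p : ℝ × ℝ => M p.1 p.2)
    (hh : IsTransmutationKernel M h k) {m : ℕ} {μ : ℂ} (hm : ∀ j < m, charCoeff h μ j = 0)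
    (n : ℕ) (hn : n ≤ m) (c : ℕ → ℂ) :
    IsRootFunction M μ n (transmute h (expPoly μ n c)) := by
  induction n generalizing c with
  | zero => exact fun x _ => transmute_expPoly_zero h μ c x
  | succ n ih =>
    refine ⟨⟨differentiableOn_transmute_expPoly hM hh μ _ c,
      transmute_expPoly_pi hh.continuous_h hm c _ hn⟩, _, ih (by omega) (fun j => c (j + 1)),
      fun x hx => ?_⟩
    rw [integroDiff_transmute_expPoly hM hh μ n c hx]
    ring

/-- However long the chain, m coefficients suffice: each integration of `ℓ y - μ y = z` adds one
coefficient, and the condition y(π) = 0 removes the top one, since `charCoeff h μ m ≠ 0`. -/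
theorem IsRootFunction.exists_eq_transmute_expPoly (hM : Continuous fun p : ℝ × ℝ => M p.1 p.2)
    (hh : IsTransmutationKernel M h k) {m : ℕ} {μ : ℂ} (hm : ∀ j < m, charCoeff h μ j = 0)
    (hm' : charCoeff h μ m ≠ 0) {n : ℕ} {y : ℝ → ℂ} (hy : IsRootFunction M μ n y) :
    ∃ c : ℕ → ℂ, ∀ x ∈ Set.Icc 0 π, y x = transmute h (expPoly μ m c) x := by
  induction n generalizing y with
  | zero =>
    refine ⟨fun _ => 0, fun x hx => ?_⟩
    have h1 : expPoly μ m (fun _ => 0) = fun _ => 0 := by funext t; simp [expPoly]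
    have h2 : y x = 0 := hy x hx
    simp [h2, h1, transmute]
  | succ n ih =>
    obtain ⟨⟨hyd, hyπ⟩, z, hz, hyz⟩ := hy
    obtain ⟨c, hc⟩ := ih hz
    -- The sequence y 0, c 0, c 1, …: the shift reproduces z under `ℓ - μ`, and the new leading
    -- entry matches y at 0, so uniqueness applies to the difference.
    let c' : ℕ → ℂ := fun j => Nat.casesOn j (y 0) c
    have hd := differentiableOn_transmute_expPoly hM hh μ (m + 1) c'
    have heq : ∀ x ∈ Set.Icc 0 π, y x - transmute h (expPoly μ (m + 1) c') x = 0 := by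
      refine eq_zero_of_integroDiff_eq hM (μ := μ) (hyd.sub hd) ?_ fun x hx => ?_
      · rw [transmute_expPoly_succ_at_zero]; exact sub_self _
      · rw [integroDiff_sub hM hyd hd hx, integroDiff_transmute_expPoly hM hh μ m c' hx]
        have h1 := hyz x hx
        have h2 : transmute h (expPoly μ m fun j => c' (j + 1)) x = z x := (hc x hx).symm
        rw [h2]
        linear_combination h1
    have hcm : c' m = 0 := by
      have h1 := heq π ⟨Real.pi_pos.le, le_rfl⟩
      rw [transmute_expPoly_succ hh.continuous_h,
        transmute_expPoly_pi hh.continuous_h hm c' m le_rfl, hyπ, zero_add, zero_sub,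
        neg_eq_zero] at h1
      exact (mul_eq_zero.1 h1).resolve_right hm'
    refine ⟨c', fun x hx => ?_⟩
    rw [sub_eq_zero.1 (heq x hx), transmute_expPoly_succ hh.continuous_h, hcm, zero_mul, add_zero]

theorem isEigenvalue_iff (hM : Continuous fun p : ℝ × ℝ => M p.1 p.2)
    (hh : IsTransmutationKernel M h k) {m : ℕ} {μ : ℂ} (hm : ∀ j < m, charCoeff h μ j = 0)
    (hm' : charCoeff h μ m ≠ 0) : IsEigenvalue M μ ↔ m ≠ 0 := by
  constructor
  · rintro ⟨y, hy, hyμ, x, hx, hyx⟩ rfl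
    have h1 : IsRootFunction M μ 1 y :=
      ⟨hy, fun _ => 0, fun _ _ => rfl, fun x hx => by rw [hyμ x hx, sub_self]⟩
    obtain ⟨c, hc⟩ := h1.exists_eq_transmute_expPoly hM hh hm hm'
    exact hyx (by rw [hc x hx, transmute_expPoly_zero])
  · intro hm0
    obtain ⟨hd, z, hz, hzy⟩ := isRootFunction_transmute_expPoly hM hh hm 1 (by omega) (fun _ => 1)
    refine ⟨_, hd, fun x hx => ?_, 0, ⟨le_rfl, Real.pi_pos.le⟩, ?_⟩
    · have := hzy x hx
      rwa [hz x hx, sub_eq_zero] at this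
    · rw [transmute_expPoly_succ_at_zero]
      exact one_ne_zero

theorem algMultiplicity_eq (hM : Continuous fun p : ℝ × ℝ => M p.1 p.2)
    (hh : IsTransmutationKernel M h k) {m : ℕ} {μ : ℂ} (hm : ∀ j < m, charCoeff h μ j = 0)
    (hm' : charCoeff h μ m ≠ 0) : algMultiplicity M μ = m := by
  let e : ℕ → Set.Icc (0 : ℝ) π → ℂ := fun j x =>
    transmute h (fun t => (-Complex.I * t) ^ j / (j.factorial : ℂ) *
      Complex.exp (-Complex.I * μ * t)) x
  have hsum : ∀ (n : ℕ) (c : ℕ → ℂ) (x : Set.Icc (0 : ℝ) π),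
      transmute h (expPoly μ n c) x = ∑ j ∈ Finset.range n, c j * e j x := by
    intro n c x
    induction n with
    | zero => simp [transmute_expPoly_zero]
    | succ n ih => rw [transmute_expPoly_succ hh.continuous_h, ih, Finset.sum_range_succ]
  let v : Fin m → Set.Icc (0 : ℝ) π → ℂ := fun j => e j
  have hv : LinearIndependent ℂ v := by
    rw [Fintype.linearIndependent_iff]
    intro g hg j
    let c : ℕ → ℂ := fun j => if hj : j < m then g ⟨j, hj⟩ else 0
    have h1 := expPoly_coeff_eq_zero hM hh μ m c (fun x hx => by
      rw [hsum m c ⟨x, hx⟩, Finset.sum_range]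
      have := congrFun hg ⟨x, hx⟩
      simpa [c, v] using this) j j.2
    simpa [c] using h1
  have hspan : rootSpace M μ = Submodule.span ℂ (Set.range v) := by
    refine le_antisymm (Submodule.span_le.2 ?_) (Submodule.span_le.2 ?_)
    · rintro _ ⟨y, ⟨n, hy⟩, rfl⟩
      obtain ⟨c, hc⟩ := hy.exists_eq_transmute_expPoly hM hh hm hm'
      have : (Set.Icc (0 : ℝ) π).domRestrict y = ∑ j : Fin m, c j • v j := by
        funext x
        have := hc x x.2
        rw [hsum m c x, Finset.sum_range] at this
        simpa [v] using this
      rw [this]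
      exact Submodule.sum_mem _ fun j _ =>
        Submodule.smul_mem _ _ (Submodule.subset_span ⟨j, rfl⟩)
    · rintro _ ⟨j, rfl⟩
      refine Submodule.subset_span ⟨_, ⟨m, isRootFunction_transmute_expPoly hM hh hm m le_rfl
        (fun i => if i = j then 1 else 0)⟩, ?_⟩
      funext x
      have := hsum m (fun i => if i = (j : ℕ) then 1 else 0) x
      simpa [v, j.2] using this
  rw [algMultiplicity, hspan, rank_span hv, Cardinal.mk_range_eq _ hv.injective, Cardinal.mk_fin]

end

/-! ### The characteristic function and its recovery from the spectrum -/

section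

variable {M h k : ℝ → ℝ → ℂ}

theorem hasDerivAt_transmute_pow_mul_exp (hh : Continuous fun p : ℝ × ℝ => h p.1 p.2) (j : ℕ)
    (z : ℂ) : HasDerivAt
      (fun z => transmute h (fun t => (-Complex.I * t) ^ j * Complex.exp (-Complex.I * z * t)) π)
      (transmute h (fun t => (-Complex.I * t) ^ (j + 1) * Complex.exp (-Complex.I * z * t)) π)
      z := by
  have hd : ∀ (z : ℂ) (t : ℝ), HasDerivAt
      (fun z : ℂ => (-Complex.I * t) ^ j * Complex.exp (-Complex.I * z * t))
      ((-Complex.I * t) ^ (j + 1) * Complex.exp (-Complex.I * z * t)) z := by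
    intro z t
    have h1 := ((((hasDerivAt_id z).const_mul (-Complex.I)).mul_const (t : ℂ)).cexp).const_mul
      ((-Complex.I * t) ^ j)
    refine h1.congr_deriv ?_
    simp only [id_eq]
    ring
  refine (hd z π).add ?_
  have hF' : Continuous fun p : ℂ × ℝ => h (π - p.2) p.2 *
      ((-Complex.I * p.2) ^ (j + 1) * Complex.exp (-Complex.I * p.1 * p.2)) := by fun_prop
  obtain ⟨C, hC⟩ := ((isCompact_closedBall z 1).prod
    (isCompact_Icc (a := (0 : ℝ)) (b := π))).exists_bound_of_continuousOn hF'.continuousOn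
  refine (intervalIntegral.hasDerivAt_integral_of_dominated_loc_of_deriv_le
    (F := fun z t => h (π - t) t * ((-Complex.I * t) ^ j * Complex.exp (-Complex.I * z * t)))
    (F' := fun z t => h (π - t) t *
      ((-Complex.I * t) ^ (j + 1) * Complex.exp (-Complex.I * z * t)))
    (s := Metric.closedBall z 1) (bound := fun _ => C)
    (Metric.closedBall_mem_nhds z one_pos) ?_ ?_ ?_ ?_ ?_ ?_).2
  · exact Filter.Eventually.of_forall fun w =>
      Continuous.aestronglyMeasurable (by fun_prop)
  · exact Continuous.intervalIntegrable (by fun_prop) _ _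
  · exact Continuous.aestronglyMeasurable (by fun_prop)
  · refine Filter.Eventually.of_forall fun t ht w hw => ?_
    rw [Set.uIoc_of_le Real.pi_pos.le] at ht
    exact hC (w, t) ⟨hw, ht.1.le, ht.2⟩
  · exact intervalIntegrable_const
  · exact Filter.Eventually.of_forall fun t _ w _ => (hd w t).const_mul _

/-- The characteristic function, whose zeros are the eigenvalues. -/
noncomputable def charFun (h : ℝ → ℝ → ℂ) (z : ℂ) : ℂ :=
  transmute h (fun t => Complex.exp (-Complex.I * z * t)) π

theorem iteratedDeriv_charFun (hh : Continuous fun p : ℝ × ℝ => h p.1 p.2) (j : ℕ) (z : ℂ) :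
    iteratedDeriv j (charFun h) z = j.factorial * charCoeff h z j := by
  have h1 : ∀ j, iteratedDeriv j (charFun h) = fun z =>
      transmute h (fun t => (-Complex.I * t) ^ j * Complex.exp (-Complex.I * z * t)) π := by
    intro j
    induction j with
    | zero => funext z; simp [charFun]
    | succ j ih =>
      rw [iteratedDeriv_succ, ih]
      funext z
      exact (hasDerivAt_transmute_pow_mul_exp hh j z).deriv
  have h2 : (j.factorial : ℂ) ≠ 0 := by exact_mod_cast j.factorial_ne_zero
  rw [h1, charCoeff, ← transmute_const_mul]
  refine congrArg (fun g => transmute h g π) (funext fun t => ?_)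
  field_simp

theorem differentiable_charFun (hh : Continuous fun p : ℝ × ℝ => h p.1 p.2) :
    Differentiable ℂ (charFun h) := by
  have h0 : charFun h = fun z =>
      transmute h (fun t => (-Complex.I * t) ^ 0 * Complex.exp (-Complex.I * z * t)) π := by
    funext z
    simp [charFun]
  rw [h0]
  exact fun z => (hasDerivAt_transmute_pow_mul_exp hh 0 z).differentiableAt

theorem norm_exp_neg_I_mul_le (z : ℂ) {t : ℝ} (ht : t ∈ Set.Icc 0 π) :
    ‖Complex.exp (-Complex.I * z * t)‖ ≤ Real.exp (π * ‖z‖) := by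
  rw [Complex.norm_exp]
  gcongr
  refine (Complex.re_le_norm _).trans ?_
  simp only [norm_mul, norm_neg, Complex.norm_I, one_mul, Complex.norm_real]
  rw [Real.norm_of_nonneg ht.1, mul_comm]
  gcongr
  exact ht.2

theorem exists_norm_charFun_le (hh : Continuous fun p : ℝ × ℝ => h p.1 p.2) :
    ∃ A, 0 ≤ A ∧ ∀ z, ‖charFun h z‖ ≤ Real.exp (A * (1 + ‖z‖)) := by
  obtain ⟨C, hC0, hC⟩ := exists_norm_le_on_square hh π
  have hπ := Real.pi_pos
  refine ⟨π * (C + 1), by positivity, fun z => ?_⟩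
  have h1 : ‖∫ t in (0 : ℝ)..π, h (π - t) t * Complex.exp (-Complex.I * z * t)‖ ≤
      C * Real.exp (π * ‖z‖) * |π - 0| := by
    refine intervalIntegral.norm_integral_le_of_norm_le_const fun t ht => ?_
    rw [Set.uIoc_of_le hπ.le] at ht
    rw [norm_mul]
    have h2 := hC (π - t) ⟨by linarith [ht.2], by linarith [ht.1]⟩ t ⟨ht.1.le, ht.2⟩
    have h3 := norm_exp_neg_I_mul_le z ⟨ht.1.le, ht.2⟩
    gcongr
  rw [sub_zero, abs_of_pos hπ] at h1
  have h2 := norm_exp_neg_I_mul_le z (t := π) ⟨hπ.le, le_rfl⟩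
  calc ‖charFun h z‖ ≤ Real.exp (π * ‖z‖) + C * Real.exp (π * ‖z‖) * π :=
        (norm_add_le _ _).trans (add_le_add h2 h1)
    _ = (π * C + 1) * Real.exp (π * ‖z‖) := by ring
    _ ≤ Real.exp (π * C) * Real.exp (π * ‖z‖) := by gcongr; exact Real.add_one_le_exp _
    _ ≤ Real.exp (π * (C + 1) * (1 + ‖z‖)) := by
        rw [← Real.exp_add]
        gcongr
        nlinarith [norm_nonneg z, mul_nonneg (mul_nonneg hπ.le hC0) (norm_nonneg z)]

/-- At z = iy the leading term is exp(πy) exactly, while the integral is at most (C/y) exp(πy). -/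
theorem tendsto_exp_mul_charFun (hh : Continuous fun p : ℝ × ℝ => h p.1 p.2) :
    Filter.Tendsto (fun y : ℝ => (Real.exp (-(π * y)) : ℂ) * charFun h (Complex.I * y))
      Filter.atTop (nhds 1) := by
  obtain ⟨C, hC0, hC⟩ := exists_norm_le_on_square hh π
  have hπ := Real.pi_pos
  have hexp : ∀ y t : ℝ, Complex.exp (-Complex.I * (Complex.I * y) * t) = Real.exp (y * t) := by
    intro y t
    rw [← mul_assoc, neg_mul, Complex.I_mul_I, neg_neg, one_mul]
    push_cast
    rfl
  rw [tendsto_iff_norm_sub_tendsto_zero]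
  refine squeeze_zero' (Filter.Eventually.of_forall fun _ => norm_nonneg _) ?_
    (by simpa using tendsto_inv_atTop_zero.const_mul C)
  filter_upwards [Filter.eventually_gt_atTop 0] with y hy
  have h1 := norm_integral_le_exp_mul (f := fun t => h (π - t) t * Real.exp (y * t)) hy hC0 hπ.le
    (fun t ht => by
      rw [norm_mul, Complex.norm_real, Real.norm_of_nonneg (Real.exp_pos _).le]
      have h2 := hC (π - t) ⟨by linarith [ht.2], by linarith [ht.1]⟩ t ⟨ht.1.le, ht.2⟩
      gcongr)
  have h2 : (Real.exp (-(π * y)) : ℂ) * charFun h (Complex.I * y) - 1 =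
      Real.exp (-(π * y)) * ∫ t in (0 : ℝ)..π, h (π - t) t * Real.exp (y * t) := by
    simp only [charFun, transmute, hexp]
    rw [mul_add, ← Complex.ofReal_mul, ← Real.exp_add, mul_comm y π, neg_add_cancel, Real.exp_zero]
    push_cast
    ring
  rw [h2, norm_mul, Complex.norm_real, Real.norm_of_nonneg (Real.exp_pos _).le]
  calc _ ≤ Real.exp (-(π * y)) * (C / y * Real.exp (y * π)) := by gcongr
    _ = C * y⁻¹ := by
        rw [mul_left_comm, ← Real.exp_add, mul_comm y π, neg_add_cancel, Real.exp_zero, mul_one,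
          div_eq_mul_inv]

theorem analyticOrderAt_charFun_ne_top (hh : Continuous fun p : ℝ × ℝ => h p.1 p.2) (z : ℂ) :
    analyticOrderAt (charFun h) z ≠ ⊤ := by
  obtain ⟨y, hy⟩ := ((tendsto_exp_mul_charFun hh).eventually_ne one_ne_zero).exists
  have han : AnalyticOnNhd ℂ (charFun h) Set.univ := fun z _ =>
    (differentiable_charFun hh).analyticAt z
  refine han.analyticOrderAt_ne_top_of_isPreconnected isPreconnected_univ
    (Set.mem_univ (Complex.I * y)) (Set.mem_univ z) ?_
  rw [(han _ (Set.mem_univ _)).analyticOrderAt_eq_zero.2 (right_ne_zero_of_mul hy)]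
  exact ENat.zero_ne_top

theorem exists_analyticOrderAt_charFun (hM : Continuous fun p : ℝ × ℝ => M p.1 p.2)
    (hh : IsTransmutationKernel M h k) (z : ℂ) : ∃ m : ℕ, analyticOrderAt (charFun h) z = m ∧
      (IsEigenvalue M z ↔ m ≠ 0) ∧ algMultiplicity M z = m := by
  obtain ⟨m, hm⟩ := ENat.ne_top_iff_exists.1 (analyticOrderAt_charFun_ne_top hh.continuous_h z)
  have h1 := (analyticOrderAt_eq_nat_iff_iteratedDeriv_eq_zero
    ((differentiable_charFun hh.continuous_h).analyticAt z)).1 hm.symm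
  simp only [iteratedDeriv_charFun hh.continuous_h, mul_eq_zero, Nat.cast_eq_zero,
    Nat.factorial_ne_zero, false_or, ne_eq] at h1
  exact ⟨m, hm.symm, isEigenvalue_iff hM hh h1.1 h1.2, algMultiplicity_eq hM hh h1.1 h1.2⟩

theorem SameSpectrum.charFun_eq {M' h' k' : ℝ → ℝ → ℂ} (hs : SameSpectrum M M')
    (hM : Continuous fun p : ℝ × ℝ => M p.1 p.2) (hM' : Continuous fun p : ℝ × ℝ => M' p.1 p.2)
    (hh : IsTransmutationKernel M h k) (hh' : IsTransmutationKernel M' h' k') :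
    charFun h = charFun h' := by
  obtain ⟨A, hA0, hA⟩ := exists_norm_charFun_le hh.continuous_h
  obtain ⟨A', -, hA'⟩ := exists_norm_charFun_le hh'.continuous_h
  refine entire_eq_of_analyticOrderAt_eq (A := max A A') (differentiable_charFun hh.continuous_h)
    (differentiable_charFun hh'.continuous_h) (hA0.trans (le_max_left _ _))
    (fun z => (hA z).trans (by gcongr; exact le_max_left _ _))
    (fun z => (hA' z).trans (by gcongr; exact le_max_right _ _)) (fun z => ?_) ?_
  · obtain ⟨m, h1, h2, h3⟩ := exists_analyticOrderAt_charFun hM hh z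
    obtain ⟨m', h1', h2', h3'⟩ := exists_analyticOrderAt_charFun hM' hh' z
    rw [h1, h1']
    congr 1
    -- Multiplicities are compared only at eigenvalues; elsewhere both orders are 0.
    by_cases hz : IsEigenvalue M z
    · have := hs.2 z hz
      rw [h3, h3'] at this
      exact_mod_cast this
    · have h4 : m = 0 := by_contra fun h => hz (h2.2 h)
      have h5 : m' = 0 := by_contra fun h => hz ((hs.1 z).2 (h2'.2 h))
      rw [h4, h5]
  · have := (tendsto_exp_mul_charFun hh'.continuous_h).div (tendsto_exp_mul_charFun hh.continuous_h)
      one_ne_zero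
    rw [div_one] at this
    refine this.congr fun y => ?_
    simp only [Pi.div_apply]
    exact mul_div_mul_left _ _ (by exact_mod_cast (Real.exp_pos _).ne')

-- Real z = 2πξ already suffices: the extension of w by zero has vanishing Fourier transform, and
-- inversion holds at its continuity points, in particular inside (0,π). The endpoints follow by
-- closure.
open FourierTransform in
theorem eq_zero_of_integral_mul_exp_eq_zero {w : ℝ → ℂ} (hw : Continuous w)
    (h : ∀ z : ℂ, ∫ t in (0 : ℝ)..π, w t * Complex.exp (-Complex.I * z * t) = 0) :
    ∀ t ∈ Set.Icc 0 π, w t = 0 := by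
  have hπ := Real.pi_pos
  let f : ℝ → ℂ := Set.indicator (Set.Ioc 0 π) w
  have hf : MeasureTheory.Integrable f := by
    rw [MeasureTheory.integrable_indicator_iff measurableSet_Ioc]
    exact (hw.integrableOn_Icc (a := 0) (b := π)).mono_set Set.Ioc_subset_Icc_self
  have hF : 𝓕 f = 0 := by
    funext ξ
    rw [Real.fourier_real_eq_integral_exp_smul]
    have h1 : ∀ t : ℝ, Complex.exp (↑(-2 * π * t * ξ) * Complex.I) • f t =
        Set.indicator (Set.Ioc 0 π)
          (fun t : ℝ => w t * Complex.exp (-Complex.I * (2 * π * ξ : ℝ) * t)) t := by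
      intro t
      by_cases ht : t ∈ Set.Ioc 0 π
      · simp only [f, Set.indicator_of_mem ht, smul_eq_mul]
        rw [mul_comm]
        congr 2
        push_cast
        ring
      · simp [f, Set.indicator_of_notMem ht]
    simp_rw [h1]
    rw [MeasureTheory.integral_indicator measurableSet_Ioc, ← intervalIntegral.integral_of_le hπ.le,
      h]
    rfl
  have hIoo : ∀ t ∈ Set.Ioo 0 π, w t = 0 := by
    intro t ht
    have hev : f =ᶠ[nhds t] w := by
      filter_upwards [Ioo_mem_nhds ht.1 ht.2] with s hs
      exact Set.indicator_of_mem (Set.Ioo_subset_Ioc_self hs) _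
    have h1 := hf.fourierInv_fourier_eq (by rw [hF]; exact MeasureTheory.integrable_zero _ _ _)
      (hw.continuousAt.congr hev.symm)
    rw [hev.eq_of_nhds, hF] at h1
    rw [← h1, Real.fourierInv_eq]
    simp
  intro t ht
  have hcl : IsClosed {t | w t = 0} := isClosed_eq hw continuous_const
  rw [← closure_Ioo hπ.ne] at ht
  exact hcl.closure_subset_iff.2 hIoo ht

theorem kernel_eq_of_charFun_eq {h' : ℝ → ℝ → ℂ} (hh : Continuous fun p : ℝ × ℝ => h p.1 p.2)
    (hh' : Continuous fun p : ℝ × ℝ => h' p.1 p.2) (heq : charFun h = charFun h') :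
    ∀ t ∈ Set.Icc 0 π, h (π - t) t = h' (π - t) t := by
  intro t ht
  refine sub_eq_zero.1 (eq_zero_of_integral_mul_exp_eq_zero
    (w := fun t => h (π - t) t - h' (π - t) t) (by fun_prop) (fun z => ?_) t ht)
  have h1 := congrFun heq z
  simp only [charFun, transmute, add_right_inj] at h1
  simp only [sub_mul]
  rw [intervalIntegral.integral_sub (Continuous.intervalIntegrable (by fun_prop) _ _)
    (Continuous.intervalIntegrable (by fun_prop) _ _), h1, sub_self]

end

/-! ### The Volterra system for the difference of the data -/

/-- The Volterra argument recovering the convolution factor of the perturbation from the value of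
the transmutation kernel on the line `a + s = π`. -/
theorem eq_of_kernel_eq {M₀ R : ℝ → ℝ → ℂ} {P P' : ℝ → ℂ} {h k h' k' : ℝ → ℝ → ℂ}
    (hM₀ : Continuous fun p : ℝ × ℝ => M₀ p.1 p.2) (hR : Continuous fun p : ℝ × ℝ => R p.1 p.2)
    (hP : Continuous P) (hP' : Continuous P')
    (hh : IsTransmutationKernel (fun x t => M₀ x t + R x t * P (x - t)) h k)
    (hh' : IsTransmutationKernel (fun x t => M₀ x t + R x t * P' (x - t)) h' k')
    (hB : ∀ x ∈ Set.Ioc 0 π, (∫ t in (0 : ℝ)..x, R (π - t) (x - t)) ≠ 0)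
    (heq : ∀ t ∈ Set.Icc 0 π, h (π - t) t = h' (π - t) t) :
    ∀ x ∈ Set.Ico 0 π, P x = P' x := by
  have hπ := Real.pi_pos
  set M : ℝ → ℝ → ℂ := fun x t => M₀ x t + R x t * P (x - t) with hMdef
  have hM : Continuous fun p : ℝ × ℝ => M p.1 p.2 := by simp only [hMdef]; fun_prop
  have hhc := hh.continuous_h
  have hhc' := hh'.continuous_h
  have hkc := hh.continuous_k
  have hkc' := hh'.continuous_k
  let p : ℝ → ℂ := fun x => P x - P' x
  let δ : ℝ → ℝ → ℂ := fun a s => h a s - h' a s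
  have hp : Continuous p := hP.sub hP'
  have hδ : Continuous fun q : ℝ × ℝ => δ q.1 q.2 := hhc.sub hhc'
  -- the part of the equation for `δ` that involves `p` and `δ` on `[0, a]` only
  let e : ℝ → ℝ → ℂ := fun a τ =>
    ∫ b in (0 : ℝ)..a, (R (a + τ) (τ + (a - b)) * p b * h' (a - b) τ + M (a + τ) (τ + b) * δ b τ)
  have he : Continuous fun q : ℝ × ℝ => e q.1 q.2 :=
    continuous_integral_of_continuous (X := ℝ × ℝ) (f := fun q b =>
      R (q.1 + q.2) (q.2 + (q.1 - b)) * p b * h' (q.1 - b) q.2 + M (q.1 + q.2) (q.2 + b) * δ b q.2)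
      (by fun_prop) continuous_fst
  have hkk : ∀ a ∈ Set.Icc 0 π, ∀ τ ∈ Set.Icc 0 π,
      k a τ - k' a τ = Complex.I * (R (a + τ) τ * p a + e a τ) := by
    intro a ha τ hτ
    -- Reflecting b ↦ a - b makes p appear at b, where the weight exp(cb) bounds it. The rest is the
    -- splitting M h - M' h' = M (h - h') + (M - M') h'.
    have h1 : ∫ b in (0 : ℝ)..a, R (a + τ) (τ + (a - b)) * p b * h' (a - b) τ =
        ∫ b in (0 : ℝ)..a, R (a + τ) (τ + b) * p (a - b) * h' b τ := by
      have := intervalIntegral.integral_comp_sub_left (a := 0) (b := a)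
        (fun b => R (a + τ) (τ + b) * p (a - b) * h' b τ) a
      simpa using this
    have h2 : e a τ = (∫ b in (0 : ℝ)..a, M (a + τ) (τ + b) * h b τ) -
        ∫ b in (0 : ℝ)..a, (M₀ (a + τ) (τ + b) + R (a + τ) (τ + b) * P' (a + τ - (τ + b))) *
          h' b τ := by
      simp only [e]
      rw [intervalIntegral.integral_add (Continuous.intervalIntegrable (by fun_prop) _ _)
          (Continuous.intervalIntegrable (by fun_prop) _ _), h1,
        ← intervalIntegral.integral_add (Continuous.intervalIntegrable (by fun_prop) _ _)
          (Continuous.intervalIntegrable (by fun_prop) _ _),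
        ← intervalIntegral.integral_sub (Continuous.intervalIntegrable (by fun_prop) _ _)
          (Continuous.intervalIntegrable (by fun_prop) _ _)]
      congr 1
      funext b
      simp only [hMdef, p, δ, show a + τ - (τ + b) = a - b by ring]
      ring
    rw [hh.k_eq a ha τ hτ, hh'.k_eq a ha τ hτ, h2]
    simp only [hMdef, p, add_sub_cancel_right]
    ring
  have hδ_eq : ∀ a ∈ Set.Icc 0 π, ∀ s ∈ Set.Icc 0 π, δ a s = Complex.I *
      (p a * (∫ τ in (0 : ℝ)..s, R (a + τ) τ) + ∫ τ in (0 : ℝ)..s, e a τ) := by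
    intro a ha s hs
    simp only [δ]
    rw [hh.h_eq, hh'.h_eq, ← intervalIntegral.integral_sub
      (Continuous.intervalIntegrable (by fun_prop) _ _)
      (Continuous.intervalIntegrable (by fun_prop) _ _),
      ← intervalIntegral.integral_const_mul, ← intervalIntegral.integral_add
      (Continuous.intervalIntegrable (by fun_prop) _ _)
      (Continuous.intervalIntegrable (by fun_prop) _ _), ← intervalIntegral.integral_const_mul]
    refine intervalIntegral.integral_congr fun τ hτ => ?_
    rw [Set.uIcc_of_le hs.1] at hτ
    rw [hkk a ha τ ⟨hτ.1, hτ.2.trans hs.2⟩]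
    ring
  -- The substitution τ = π - a - t turns β(a) into B(π - a).
  let β : ℝ → ℂ := fun a => ∫ τ in (0 : ℝ)..(π - a), R (a + τ) τ
  have hβ : Continuous β := continuous_integral_of_continuous (X := ℝ)
    (f := fun a τ => R (a + τ) τ) (by fun_prop) (by fun_prop)
  have hβ0 : ∀ a ∈ Set.Ico 0 π, β a ≠ 0 := by
    intro a ha
    have h1 := hB (π - a) ⟨by linarith [ha.2], by linarith [ha.1]⟩
    have h2 := intervalIntegral.integral_comp_sub_left (a := 0) (b := π - a)
      (fun τ => R (a + τ) τ) (π - a)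
    simp only [sub_self, sub_zero] at h2
    have h3 : β a = ∫ t in (0 : ℝ)..(π - a), R (π - t) (π - a - t) := by
      rw [← show _ = β a from h2]
      congr 1
      funext t
      rw [show a + (π - a - t) = π - t by ring]
    rwa [h3]
  have hδπ : ∀ a ∈ Set.Icc 0 π, p a * β a = -∫ τ in (0 : ℝ)..(π - a), e a τ := by
    intro a ha
    have hs : π - a ∈ Set.Icc 0 π := ⟨by linarith [ha.2], by linarith [ha.1]⟩
    have h1 := hδ_eq a ha (π - a) hs
    have h2 : δ a (π - a) = 0 := by
      have := heq (π - a) hs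
      rw [sub_sub_cancel] at this
      exact sub_eq_zero.2 this
    rw [h2] at h1
    have h3 := (mul_eq_zero.1 h1.symm).resolve_left Complex.I_ne_zero
    exact eq_neg_of_add_eq_zero_left h3
  intro A hA
  obtain ⟨CR, hCR0, hCR⟩ := exists_norm_le_on_square hR (2 * π)
  obtain ⟨CM, hCM0, hCM⟩ := exists_norm_le_on_square hM (2 * π)
  obtain ⟨Ch, hCh0, hCh⟩ := exists_norm_le_on_square hhc' π
  obtain ⟨Cδ, hCδ0, hCδ⟩ := exists_norm_le_on_square hδ π
  obtain ⟨Cp, hCp⟩ := (isCompact_Icc (a := 0) (b := π)).exists_bound_of_continuousOn hp.continuousOn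
  -- β vanishes at π, so a positive lower bound is available only on [0,A] with A < π.
  obtain ⟨a₀, ha₀, hmin⟩ := (isCompact_Icc (a := 0) (b := A)).exists_isMinOn ⟨0, le_rfl, hA.1⟩
    hβ.norm.continuousOn
  set m := ‖β a₀‖ with hm
  have hm0 : 0 < m := norm_pos_iff.2 (hβ0 a₀ ⟨ha₀.1, ha₀.2.trans_lt hA.2⟩)
  set D := CR * Ch + CM with hD
  have hD0 : 0 ≤ D := by positivity
  -- Half of c dominates both constants found below, in the bounds for p and for δ in terms of E =
  -- (Q/c) exp(ca); each bound is then at most (Q/2) exp(ca).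
  set c := 2 * (π * D / m + π * CR * (π * D / m) + π * D + 1) with hc
  have hc0 : 0 < c := by positivity
  have hsub : ∀ a ∈ Set.Icc 0 A, a ∈ Set.Icc 0 π := fun a ha => ⟨ha.1, ha.2.trans hA.2.le⟩
  have hhalf := le_zero_of_forall_halving (ι := Set.Icc 0 A × Set.Icc 0 π)
    (q := fun i => max ‖p i.1‖ ‖δ i.1 i.2‖) (w := fun i => Real.exp (c * i.1))
    (Q₀ := max Cp Cδ) (hCδ0.trans (le_max_right _ _)) (fun i => by
      have h1 := hCp i.1 (hsub i.1 i.1.2)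
      have h2 := hCδ i.1 (hsub i.1 i.1.2) i.2 i.2.2
      have h3 : 1 ≤ Real.exp (c * i.1) := Real.one_le_exp (mul_nonneg hc0.le i.1.2.1)
      have h4 : max ‖p i.1‖ ‖δ i.1 i.2‖ ≤ max Cp Cδ := max_le_max h1 h2
      have h5 : 0 ≤ max Cp Cδ := hCδ0.trans (le_max_right _ _)
      nlinarith) (fun Q hQ hQw => by
      rintro ⟨⟨a, ha⟩, ⟨s, hs⟩⟩
      have hpQ : ∀ b ∈ Set.Icc 0 A, ‖p b‖ ≤ Q * Real.exp (c * b) := fun b hb =>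
        (le_max_left _ _).trans (hQw (⟨b, hb⟩, ⟨s, hs⟩))
      have hδQ : ∀ b ∈ Set.Icc 0 A, ∀ τ ∈ Set.Icc 0 π, ‖δ b τ‖ ≤ Q * Real.exp (c * b) :=
        fun b hb τ hτ => (le_max_right _ _).trans (hQw (⟨b, hb⟩, ⟨τ, hτ⟩))
      have haπ := hsub a ha
      set E := Q / c * Real.exp (c * a) with hE
      have hE0 : 0 ≤ E := by positivity
      have hebound : ∀ τ ∈ Set.Icc 0 π, ‖e a τ‖ ≤ D * E := by
        intro τ hτ
        have h1 := norm_integral_le_exp_mul (f := fun b =>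
          R (a + τ) (τ + (a - b)) * p b * h' (a - b) τ + M (a + τ) (τ + b) * δ b τ)
          (C := D * Q) hc0 (by positivity) ha.1 (fun b hb => by
            have hb' : b ∈ Set.Icc 0 A := ⟨hb.1.le, hb.2.trans ha.2⟩
            have h2 := hCR (a + τ) ⟨by linarith [ha.1, hτ.1], by linarith [haπ.2, hτ.2]⟩
              (τ + (a - b)) ⟨by linarith [hb.2, hτ.1], by linarith [haπ.2, hτ.2, hb.1]⟩
            have h3 := hCM (a + τ) ⟨by linarith [ha.1, hτ.1], by linarith [haπ.2, hτ.2]⟩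
              (τ + b) ⟨by linarith [hb.1, hτ.1], by linarith [haπ.2, hτ.2, hb.2]⟩
            have h4 := hCh (a - b) ⟨by linarith [hb.2], by linarith [hb.1, haπ.2]⟩ τ hτ
            have h5 := hpQ b hb'
            have h6 := hδQ b hb' τ hτ
            calc _ ≤ ‖R (a + τ) (τ + (a - b))‖ * ‖p b‖ * ‖h' (a - b) τ‖ +
                  ‖M (a + τ) (τ + b)‖ * ‖δ b τ‖ := by
                  refine (norm_add_le _ _).trans ?_
                  rw [norm_mul, norm_mul, norm_mul]
              _ ≤ CR * (Q * Real.exp (c * b)) * Ch + CM * (Q * Real.exp (c * b)) := by gcongr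
              _ = D * Q * Real.exp (c * b) := by rw [hD]; ring)
        refine h1.trans (le_of_eq ?_)
        rw [hE]; ring
      have heint : ∀ s ∈ Set.Icc 0 π, ‖∫ τ in (0 : ℝ)..s, e a τ‖ ≤ π * D * E := by
        intro s hs
        have h1 := intervalIntegral.norm_integral_le_of_norm_le_const (a := 0) (b := s)
          (f := fun τ => e a τ) (C := D * E) (fun τ hτ => by
            rw [Set.uIoc_of_le hs.1] at hτ
            exact hebound τ ⟨hτ.1.le, hτ.2.trans hs.2⟩)
        rw [sub_zero, abs_of_nonneg hs.1] at h1
        calc _ ≤ D * E * s := h1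
          _ ≤ D * E * π := by gcongr; exact hs.2
          _ = _ := by ring
      have hpa : ‖p a‖ ≤ π * D / m * E := by
        have h1 := heint (π - a) ⟨by linarith [haπ.2], by linarith [haπ.1]⟩
        rw [← norm_neg, ← hδπ a haπ, norm_mul] at h1
        have h2 : m ≤ ‖β a‖ := hmin ha
        rw [div_mul_eq_mul_div, le_div_iff₀ hm0]
        exact (mul_le_mul_of_nonneg_left h2 (norm_nonneg _)).trans h1
      have hδa : ‖δ a s‖ ≤ (π * CR * (π * D / m) + π * D) * E := by
        have h1 := intervalIntegral.norm_integral_le_of_norm_le_const (a := 0) (b := s)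
          (f := fun τ => R (a + τ) τ) (C := CR) (fun τ hτ => by
            rw [Set.uIoc_of_le hs.1] at hτ
            exact hCR _ ⟨by linarith [ha.1, hτ.1], by linarith [haπ.2, hτ.2, hs.2]⟩ _
              ⟨hτ.1.le, by linarith [hτ.2, hs.2]⟩)
        rw [sub_zero, abs_of_nonneg hs.1] at h1
        rw [hδ_eq a haπ s hs, norm_mul, Complex.norm_I, one_mul]
        calc _ ≤ ‖p a‖ * ‖∫ τ in (0 : ℝ)..s, R (a + τ) τ‖ + ‖∫ τ in (0 : ℝ)..s, e a τ‖ := by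
              rw [← norm_mul]; exact norm_add_le _ _
          _ ≤ (π * D / m * E) * (CR * π) + π * D * E := by
              gcongr
              · exact h1.trans (by gcongr; exact hs.2)
              · exact heint s hs
          _ = _ := by ring
      have hfin : ∀ κ, κ ≤ c / 2 → κ * E ≤ Q / 2 * Real.exp (c * a) := by
        intro κ hκ
        calc κ * E ≤ c / 2 * E := by gcongr
          _ = Q / 2 * Real.exp (c * a) := by rw [hE]; field_simp
      have h1 : 0 ≤ π * D / m := by positivity
      have h2 : 0 ≤ π * CR * (π * D / m) := by positivity
      have h3 : 0 ≤ π * D := by positivity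
      exact max_le (hpa.trans (hfin _ (by rw [hc]; linarith)))
        (hδa.trans (hfin _ (by rw [hc]; linarith))))
  have h1 := (le_max_left _ _).trans (hhalf (⟨A, hA.1, le_rfl⟩, ⟨0, le_rfl, hπ.le⟩))
  exact sub_eq_zero.1 (norm_le_zero_iff.1 h1)

/-! ### Reduction to globally continuous data -/

theorem integroDiff_congr_kernel {M N : ℝ → ℝ → ℂ}
    (h : ∀ x ∈ Set.Icc 0 π, ∀ t ∈ Set.Icc 0 x, M x t = N x t) (y : ℝ → ℂ) {x : ℝ}
    (hx : x ∈ Set.Icc 0 π) : integroDiff M y x = integroDiff N y x := by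
  unfold integroDiff
  congr 1
  refine intervalIntegral.integral_congr fun t ht => ?_
  rw [Set.uIcc_of_le hx.1] at ht
  exact congrArg (· * y t) (h x hx t ht)

theorem isEigenvalue_congr_kernel {M N : ℝ → ℝ → ℂ}
    (h : ∀ x ∈ Set.Icc 0 π, ∀ t ∈ Set.Icc 0 x, M x t = N x t) (μ : ℂ) :
    IsEigenvalue M μ ↔ IsEigenvalue N μ := by
  refine exists_congr fun y => and_congr_right fun _ => and_congr_left fun _ => ?_
  exact forall₂_congr fun x hx => by rw [integroDiff_congr_kernel h y hx]

theorem isRootFunction_congr_kernel {M N : ℝ → ℝ → ℂ}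
    (h : ∀ x ∈ Set.Icc 0 π, ∀ t ∈ Set.Icc 0 x, M x t = N x t) (μ : ℂ) (n : ℕ) (y : ℝ → ℂ) :
    IsRootFunction M μ n y ↔ IsRootFunction N μ n y := by
  induction n generalizing y with
  | zero => exact Iff.rfl
  | succ n ih =>
    refine and_congr_right fun _ => exists_congr fun z => and_congr (ih z) ?_
    exact forall₂_congr fun x hx => by rw [integroDiff_congr_kernel h y hx]

theorem algMultiplicity_congr_kernel {M N : ℝ → ℝ → ℂ}
    (h : ∀ x ∈ Set.Icc 0 π, ∀ t ∈ Set.Icc 0 x, M x t = N x t) (μ : ℂ) :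
    algMultiplicity M μ = algMultiplicity N μ := by
  have h1 : {y | ∃ k, IsRootFunction M μ k y} = {y | ∃ k, IsRootFunction N μ k y} :=
    Set.ext fun y => exists_congr fun n => isRootFunction_congr_kernel h μ n y
  rw [algMultiplicity, algMultiplicity, rootSpace, rootSpace, h1]

theorem sameSpectrum_congr_kernel {M N M' N' : ℝ → ℝ → ℂ}
    (h : ∀ x ∈ Set.Icc 0 π, ∀ t ∈ Set.Icc 0 x, M x t = N x t)
    (h' : ∀ x ∈ Set.Icc 0 π, ∀ t ∈ Set.Icc 0 x, M' x t = N' x t) :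
    SameSpectrum M M' ↔ SameSpectrum N N' := by
  simp only [SameSpectrum, isEigenvalue_congr_kernel h, isEigenvalue_congr_kernel h',
    algMultiplicity_congr_kernel h, algMultiplicity_congr_kernel h']

/-- Composition with a continuous retraction of the plane onto the triangle. The kernel equation on
the square needs M outside the triangle, while the spectrum sees only the triangle. -/
theorem exists_continuous_extension_triangle {M : ℝ → ℝ → ℂ}
    (hM : ContinuousOn (fun p : ℝ × ℝ => M p.1 p.2) triangle) : ∃ N : ℝ → ℝ → ℂ,
      (Continuous fun p : ℝ × ℝ => N p.1 p.2) ∧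
        ∀ x ∈ Set.Icc 0 π, ∀ t ∈ Set.Icc 0 x, M x t = N x t := by
  let cl : ℝ → ℝ := fun x => max 0 (min x π)
  let cl₂ : ℝ → ℝ → ℝ := fun x t => max 0 (min t (cl x))
  refine ⟨fun x t => M (cl x) (cl₂ x t), ?_, fun x hx t ht => ?_⟩
  · refine hM.comp_continuous
      (by fun_prop : Continuous fun p : ℝ × ℝ => (cl p.1, cl₂ p.1 p.2)) fun p => ?_
    have h0 : 0 ≤ cl p.1 := le_max_left _ _
    exact ⟨le_max_left _ _, max_le h0 (min_le_right _ _),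
      max_le Real.pi_pos.le (min_le_right _ _)⟩
  · have h1 : cl x = x := by simp only [cl, min_eq_left hx.2, max_eq_right hx.1]
    simp only [cl₂, h1, min_eq_left ht.2, max_eq_right ht.1]

theorem theorem2 (M₀ R : ℝ → ℝ → ℂ) (P P' : ℝ → ℂ)
    (hM₀ : ContinuousOn (fun p : ℝ × ℝ => M₀ p.1 p.2) triangle)
    (hR : ContinuousOn (fun p : ℝ × ℝ => R p.1 p.2) triangle)
    (hP : ContinuousOn P (Set.Icc 0 π))
    (hP' : ContinuousOn P' (Set.Icc 0 π))
    (hB : ∀ x ∈ Set.Ioc 0 π, (∫ t in (0 : ℝ)..x, R (π - t) (x - t)) ≠ 0)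
    (hspec : SameSpectrum (fun x t => M₀ x t + R x t * P (x - t))
      (fun x t => M₀ x t + R x t * P' (x - t))) :
    ∀ x ∈ Set.Icc 0 π, P x = P' x := by
  have hπ := Real.pi_pos
  obtain ⟨N₀, hN₀, hMN⟩ := exists_continuous_extension_triangle hM₀
  obtain ⟨S, hS, hRS⟩ := exists_continuous_extension_triangle hR
  have hext : ∀ {p : ℝ → ℂ}, ContinuousOn p (Set.Icc 0 π) →
      ∃ q : ℝ → ℂ, Continuous q ∧ ∀ x ∈ Set.Icc 0 π, p x = q x := fun {p} hp =>
    ⟨Set.IccExtend hπ.le ((Set.Icc 0 π).domRestrict p), hp.domRestrict.Icc_extend', fun x hx => by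
      rw [Set.IccExtend_of_mem hπ.le _ hx]; rfl⟩
  obtain ⟨q, hq, hPq⟩ := hext hP
  obtain ⟨q', hq', hPq'⟩ := hext hP'
  have hker : ∀ {p r : ℝ → ℂ}, (∀ x ∈ Set.Icc 0 π, p x = r x) → ∀ x ∈ Set.Icc 0 π,
      ∀ t ∈ Set.Icc 0 x, M₀ x t + R x t * p (x - t) = N₀ x t + S x t * r (x - t) :=
    fun hpr x hx t ht => by
      rw [hMN x hx t ht, hRS x hx t ht, hpr (x - t) ⟨by linarith [ht.2], by linarith [ht.1, hx.2]⟩]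
  have hspec' := (sameSpectrum_congr_kernel (hker hPq) (hker hPq')).1 hspec
  have hc : Continuous fun p : ℝ × ℝ => N₀ p.1 p.2 + S p.1 p.2 * q (p.1 - p.2) := by fun_prop
  have hc' : Continuous fun p : ℝ × ℝ => N₀ p.1 p.2 + S p.1 p.2 * q' (p.1 - p.2) := by fun_prop
  obtain ⟨h, k, hh⟩ := exists_isTransmutationKernel
    (M := fun x t => N₀ x t + S x t * q (x - t)) hc
  obtain ⟨h', k', hh'⟩ := exists_isTransmutationKernel
    (M := fun x t => N₀ x t + S x t * q' (x - t)) hc'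
  have heq := kernel_eq_of_charFun_eq hh.continuous_h hh'.continuous_h
    (hspec'.charFun_eq hc hc' hh hh')
  have hBS : ∀ x ∈ Set.Ioc 0 π, (∫ t in (0 : ℝ)..x, S (π - t) (x - t)) ≠ 0 := by
    intro x hx
    have h1 : ∫ t in (0 : ℝ)..x, S (π - t) (x - t) = ∫ t in (0 : ℝ)..x, R (π - t) (x - t) := by
      refine intervalIntegral.integral_congr fun t ht => ?_
      rw [Set.uIcc_of_le hx.1.le] at ht
      exact (hRS _ ⟨by linarith [ht.2, hx.2], by linarith [ht.1]⟩ _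
        ⟨by linarith [ht.2], by linarith [hx.2]⟩).symm
    rw [h1]
    exact hB x hx
  have hIco := eq_of_kernel_eq hN₀ hS hq hq' hh hh' hBS heq
  -- The Volterra argument stops short of π; the endpoint is reached by continuity.
  have hcl : IsClosed {x | q x = q' x} := isClosed_eq hq hq'
  intro x hx
  rw [hPq x hx, hPq' x hx]
  rw [← closure_Ico hπ.ne] at hx
  exact hcl.closure_subset_iff.2 hIco hx
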